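/- Let $n\ge 1$ and let $c=(c_1,\dots,c_{n-1})$ be a sequence of nonnegative integers with $c_1+\cdots+c_{n-1}=n-1$. Put $$y_c = x_1^{c_1}(x_1+x_2)^{c_2}\cdots(x_1+\cdots+x_{n-1})^{c_{n-1}}\in\mathbb{Q}[x_1,\dots,x_n].$$ Let $\mathrm{QSym}_n^+$ be the ideal of $\mathbb{Q}[x_1,\dots,x_n]$ generated by the quasisymmetric polynomials without constant term, and let $\mathrm{ABB}_n$ be the set of exponent vectors $(d_1,\dots,d_n)\in\mathbb{Z}_{\ge0}^n$ with $\sum_{1\le i\le j} d_{n+1-i}\le j-1$ for all $j=1,\dots,n$. Let the multivariate mixed Eulerian number $A_c(x_1,\dots,x_{n-1})$ be the reduction of $y_c$ modulo $\mathrm{QSym}_n^+$, that is, the representative of $y_c$ modulo $\mathrm{QSym}_n^+$ lying in the span of the monomials $x^d$, $d\in \mathrm{ABB}_n$ (these do not involve $x_n$); this representative exists and is unique. Consider letters $i^{(j)}$ with $i\in\mathbb{Z}$, $j\in\mathbb{Z}_{\ge1}$, ordered lexicographically by $(i,j)$, with $\mathrm{val}(i^{(j)})=i$. For a word $W=W_1\cdots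 W_k$ with pairwise distinct letters, define a finite set $\Omega(W)\subset\mathbb{Z}$ recursively: $\Omega$ of the empty word is empty, and for $W=W'a$: - if $\mathrm{val}(a)\notin\Omega(W')$, then $\Omega(W)=\Omega(W')\sqcup\{\mathrm{val}(a)\}$; - otherwise let $I$ be the maximal interval of consecutive integers in $\Omega(W')$ that contains $\mathrm{val}(a)$, and let $b=W_i$ with $i\le|W'|$ maximal such that $\mathrm{val}(W_i)\in I$; then $\Omega(W)=\Omega(W')\sqcup\{\min I-1\}$ if $a<b$, and $\Omega(W)=\Omega(W')\sqcup\{\max I+1\}$ if $a>b$. The word $W$ is an $\Omega$-parking word if $\Omega(W)=\{1,\dots,|W|\}$. Let $\mathbb{Z}_c=\{i^{(j)} : 1\le i\le n-1,\ 1\le j\le c_i\}$. There are $(n-1)!$ words of length $n-1$ with pairwise distinct letters in $\mathbb{Z}_c$, and the number of those that are $\Omega$-parking words equals the mixed Eulerian number $A_c(1^{n-1})=A_c(1,\dots,1)$. -/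

import Mathlib

open MvPolynomial

namespace OmegaParking

/-! ### Reduction modulo positive degree quasisymmetric polynomials

The variables `x_1, …, x_n` are `X 0, …, X (n-1)`, indexed by `Fin n`. -/

/-- `f ∈ ℚ[x_1, …, x_n]` is quasisymmetric: for every strong composition `α` with `k` parts, the
coefficients of `x_{i_1}^{α_1} ⋯ x_{i_k}^{α_k}` and `x_{j_1}^{α_1} ⋯ x_{j_k}^{α_k}` agree whenever
`i_1 < ⋯ < i_k` and `j_1 < ⋯ < j_k`. -/
def IsQuasisymmetric {n : ℕ} (f : MvPolynomial (Fin n) ℚ) : Prop :=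
  ∀ (k : ℕ) (α : Fin k → ℕ) (i j : Fin k → Fin n), (∀ t, 0 < α t) → StrictMono i → StrictMono j →
    coeff (∑ t, Finsupp.single (i t) (α t)) f = coeff (∑ t, Finsupp.single (j t) (α t)) f

/-- The ideal `QSym_n^+` of `ℚ[x_1, …, x_n]`, generated by the quasisymmetric polynomials that have
only terms of positive degree. -/
noncomputable def qsymIdeal (n : ℕ) : Ideal (MvPolynomial (Fin n) ℚ) :=
  Ideal.span {f | IsQuasisymmetric f ∧ constantCoeff f = 0}

/-- The set `ABB_n` of exponent vectors `(d_1, …, d_n)` such that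
`d_n + d_{n-1} + ⋯ + d_{n+1-j} ≤ j - 1` for `j = 1, …, n` (all indices are shifted by one). -/
def abbVectors (n : ℕ) : Set (Fin n →₀ ℕ) :=
  {d | ∀ j : Fin n, ∑ i ∈ Finset.Iic j, d (Fin.rev i) ≤ (j : ℕ)}

/-- The `ℚ`-span of the ABB monomials `x^d`, `d ∈ ABB_n`. -/
noncomputable def abbSpan (n : ℕ) : Submodule ℚ (MvPolynomial (Fin n) ℚ) :=
  Submodule.span ℚ ((fun d => monomial d (1 : ℚ)) '' abbVectors n)

/-- `r` is a representative of `f` modulo `QSym_n^+` in the span of the ABB monomials. -/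
def IsABBReduction {n : ℕ} (f r : MvPolynomial (Fin n) ℚ) : Prop :=
  r ∈ abbSpan n ∧ f - r ∈ qsymIdeal n

open Classical in
/-- `f mod QSym_n^+`, the representative of `f` in the span of the ABB monomials. -/
noncomputable def abbReduction {n : ℕ} (f : MvPolynomial (Fin n) ℚ) : MvPolynomial (Fin n) ℚ :=
  if h : ∃ r, IsABBReduction f r then h.choose else 0

/-! ### Multivariate mixed Eulerian numbers

Below `n = m + 1`, and `c = (c_1, …, c_{n-1})` is given by `c : Fin m → ℕ`. -/

/-- `y_c = x_1^{c_1} (x_1 + x_2)^{c_2} ⋯ (x_1 + ⋯ + x_{n-1})^{c_{n-1}}`, in `ℚ[x_1, …, x_n]`. -/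
noncomputable def yPoly {m : ℕ} (c : Fin m → ℕ) : MvPolynomial (Fin (m + 1)) ℚ :=
  ∏ i : Fin m, (∑ j ∈ Finset.Iic i, X j.castSucc) ^ c i

/-- The multivariate mixed Eulerian number `A_c(x_1, …, x_{n-1}) = y_c mod QSym_n^+`. It lives in
`ℚ[x_1, …, x_n]`, but an ABB vector has last entry `0`, so that `x_n` does not occur in it. -/
noncomputable def mixedEulerian {m : ℕ} (c : Fin m → ℕ) : MvPolynomial (Fin (m + 1)) ℚ :=
  abbReduction (yPoly c)

/-! ### The parking procedure -/

/-- The ordered alphabet of letters `i^(j)`, with `i ∈ ℤ` and `j ≥ 1`, in lexicographic order: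
`i^(1) < i^(2) < ⋯ < (i+1)^(1) < ⋯`. -/
abbrev Letter : Type := ℤ ×ₗ ℕ+

/-- The value `i` of the letter `i^(j)`: the spot that the car prefers. -/
def Letter.val (a : Letter) : ℤ := (ofLex a).1

/-- The superscript `j` of the letter `i^(j)`. -/
def Letter.sup (a : Letter) : ℕ+ := (ofLex a).2

/-- For `x ∈ S`, the maximal interval of consecutive integers that contains `x` and lies in `S`. -/
def block (S : Finset ℤ) (x : ℤ) : Finset ℤ :=
  S.filter fun y => Finset.uIcc x y ⊆ S

theorem block_nonempty {S : Finset ℤ} {x : ℤ} (h : x ∈ S) : (block S x).Nonempty :=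
  ⟨x, by simp [block, h]⟩

/-- The occupied spots after the cars of a word have parked. The word is listed backwards, the most
recent car first. If the spot `val a` preferred by the new car `a` is free, then it parks there.
Otherwise `val a` lies in a maximal interval `I` of occupied spots; if `b` is the last earlier car
whose preferred spot lies in `I`, then the new car parks at `min I - 1` if `a < b` and at
`max I + 1` if `a > b`. (A car parks in the interval that then contains its preferred spot, so there
is always such a `b`: the case `none` does not arise.) -/
def spotsRev : List Letter → Finset ℤ
  | [] => ∅
  | a :: W =>
    if h : a.val ∈ spotsRev W then
      match W.find? (fun b => b.val ∈ block (spotsRev W) a.val) with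
      | some b =>
        if a < b then
          insert ((block (spotsRev W) a.val).min' (block_nonempty h) - 1) (spotsRev W)
        else
          insert ((block (spotsRev W) a.val).max' (block_nonempty h) + 1) (spotsRev W)
      | none => spotsRev W
    else
      insert a.val (spotsRev W)

/-- The set `Ω(W)` of occupied spots after the cars `W_1, W_2, …` have parked in this order. -/
def spots (W : List Letter) : Finset ℤ := spotsRev W.reverse

/-- `W` is an `Ω`-parking word: `Ω(W) = {1, …, |W|}`. -/
def IsParkingWord (W : List Letter) : Prop := spots W = Finset.Icc 1 (W.length : ℤ)

/-- The alphabet `ℤ_c` of the letters `i^(j)` with `1 ≤ i ≤ n - 1` and `1 ≤ j ≤ c_i`. -/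
def alphabet {m : ℕ} (c : Fin m → ℕ) : Set Letter :=
  {a | ∃ i : Fin m, a.val = (i : ℤ) + 1 ∧ (a.sup : ℕ) ≤ c i}

/-- The injective words of length `n - 1` in the alphabet `ℤ_c`. -/
def injectiveWords {m : ℕ} (c : Fin m → ℕ) : Set (List Letter) :=
  {W | W.Nodup ∧ W.length = m ∧ ∀ a ∈ W, a ∈ alphabet c}

end OmegaParking

/-!
The trimming operators `f ↦ (f(…, x_i, 0, …) - f(…, 0, x_i, …)) / x_i` annihilate quasisymmetric
polynomials and satisfy a Leibniz rule, so they map the ideal generated by the quasisymmetric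
polynomials without constant term into the same ideal in one variable less. They also preserve the
span of the ABB monomials, on which their common kernel consists of constants. By induction on the
number of variables this makes the reduction unique. It exists because the fundamental
quasisymmetric polynomials rewrite every monomial whose exponent vector is not in `ABB_n`.

On an ABB polynomial of top degree the sum of the trimming operators preserves the sum of the
coefficients, hence `A_c(1, …, 1) = (∑ i, trim_i)^(n-1) y_c`. By the Leibniz rule, trimming `y_c`
removes one factor `x_1 + ⋯ + x_k`, sets `x_i` to zero in some of the other factors and `x_{i+1}`
to zero in the rest. The removal of the first car of an `Ω`-parking word, together with the spot it
occupies, changes the preferences of the other cars in the same way, so both sides of the identity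
satisfy the same recursion.
-/

namespace OmegaParking

section OmitVar

variable {R : Type*} [CommSemiring R] {n : ℕ}

/-- The algebra map `R[x_0, …, x_n] → R[x_0, …, x_{n-1}]` that sets `x_i` to zero and shifts the
later variables down (the Bergeron–Sottile map). -/
noncomputable def omitVar (i : Fin (n + 1)) :
    MvPolynomial (Fin (n + 1)) R →ₐ[R] MvPolynomial (Fin n) R :=
  killCompl (Fin.succAbove_right_injective (p := i))

theorem coeff_omitVar (i : Fin (n + 1)) (f : MvPolynomial (Fin (n + 1)) R) (e : Fin n →₀ ℕ) :
    coeff e (omitVar i f) = coeff (e.mapDomain i.succAbove) f :=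
  coeff_killCompl _

@[simp] theorem omitVar_rename_succAbove (i : Fin (n + 1)) (f : MvPolynomial (Fin n) R) :
    omitVar i (rename i.succAbove f) = f :=
  killCompl_rename_app _ f

@[simp] theorem omitVar_X_succAbove (i : Fin (n + 1)) (j : Fin n) :
    omitVar i (X (i.succAbove j) : MvPolynomial _ R) = X j := by
  rw [← rename_X, omitVar_rename_succAbove]

@[simp] theorem omitVar_X_self (i : Fin (n + 1)) : omitVar i (X i : MvPolynomial _ R) = 0 :=
  killCompl_monomial_eq_zero_of_notMem_range _ 1 (a := i) (by simp) (by simp)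

theorem constantCoeff_omitVar (i : Fin (n + 1)) (f : MvPolynomial (Fin (n + 1)) R) :
    constantCoeff (omitVar i f) = constantCoeff f := by
  rw [constantCoeff_eq, constantCoeff_eq, coeff_omitVar, Finsupp.mapDomain_zero]

theorem omitVar_omitVar_zero (i : Fin (n + 1)) (f : MvPolynomial (Fin (n + 2)) R) :
    omitVar i (omitVar 0 f) = omitVar 0 (omitVar i.succ f) := by
  ext e
  simp only [coeff_omitVar, ← Finsupp.mapDomain_comp]
  congr 2
  ext j
  simp [Fin.succ_succAbove_succ]

end OmitVar

section Trim

variable {R : Type*} [CommRing R] {n : ℕ}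

theorem succAbove_succ_eq_succAbove_castSucc {i j : Fin n} (h : j ≠ i) :
    i.succ.succAbove j = i.castSucc.succAbove j := by
  rcases h.lt_or_gt with hj | hj
  · rw [Fin.succAbove_succ_of_le _ _ hj.le, Fin.succAbove_castSucc_of_lt _ _ hj]
  · rw [Fin.succAbove_succ_of_lt _ _ hj, Fin.succAbove_castSucc_of_le _ _ hj.le]

theorem X_dvd_omitVar_sub (i : Fin n) (f : MvPolynomial (Fin (n + 1)) R) :
    X i ∣ omitVar i.succ f - omitVar i.castSucc f := by
  rw [X_dvd_iff_modMonomial_eq_zero]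
  ext e
  by_cases h : Finsupp.single i 1 ≤ e
  · exact coeff_modMonomial_of_le _ h
  · have hi : i ∉ e.support := fun hi =>
      h (Finsupp.single_le_iff.2 (Nat.one_le_iff_ne_zero.2 (Finsupp.mem_support_iff.1 hi)))
    rw [coeff_modMonomial_of_not_le _ h, coeff_sub, coeff_omitVar, coeff_omitVar,
      Finsupp.mapDomain_congr fun j hj =>
        succAbove_succ_eq_succAbove_castSucc (ne_of_mem_of_not_mem hj hi), sub_self, coeff_zero]

/-- The trimming operator, that is the quasisymmetric divided difference
`(f(…, x_i, 0, …) - f(…, 0, x_i, …)) / x_i`. The division is exact by `X_dvd_omitVar_sub`. -/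
noncomputable def trim (i : Fin n) :
    MvPolynomial (Fin (n + 1)) R →ₗ[R] MvPolynomial (Fin n) R where
  toFun f := (omitVar i.succ f - omitVar i.castSucc f).divMonomial (Finsupp.single i 1)
  map_add' f g := by
    rw [← add_divMonomial, map_add, map_add, add_sub_add_comm]
  map_smul' c f := by
    ext e
    simp [coeff_divMonomial, mul_sub]

theorem coeff_trim (i : Fin n) (f : MvPolynomial (Fin (n + 1)) R) (e : Fin n →₀ ℕ) :
    coeff e (trim i f) = coeff ((Finsupp.single i 1 + e).mapDomain i.succ.succAbove) f -
      coeff ((Finsupp.single i 1 + e).mapDomain i.castSucc.succAbove) f := by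
  simp only [trim, LinearMap.coe_mk, AddHom.coe_mk, coeff_divMonomial, coeff_sub, coeff_omitVar]

theorem X_mul_trim (i : Fin n) (f : MvPolynomial (Fin (n + 1)) R) :
    X i * trim i f = omitVar i.succ f - omitVar i.castSucc f := by
  have h := divMonomial_add_modMonomial_single (omitVar i.succ f - omitVar i.castSucc f) i
  rwa [X_dvd_iff_modMonomial_eq_zero.1 (X_dvd_omitVar_sub i f), add_zero] at h

theorem trim_eq_zero_iff (i : Fin n) (f : MvPolynomial (Fin (n + 1)) R) :
    trim i f = 0 ↔ omitVar i.succ f = omitVar i.castSucc f := by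
  rw [← sub_eq_zero (a := omitVar _ f), ← X_mul_trim, ← X_mul_cancel_left_iff (i := i), mul_zero]

theorem trim_mul (i : Fin n) (f g : MvPolynomial (Fin (n + 1)) R) :
    trim i (f * g) = trim i f * omitVar i.succ g + omitVar i.castSucc f * trim i g := by
  rw [← X_mul_cancel_left_iff (i := i), mul_add, X_mul_trim, ← mul_assoc, X_mul_trim,
    mul_left_comm, X_mul_trim, map_mul, map_mul]
  ring

end Trim

/-! ### Quasisymmetric polynomials -/

theorem exists_strictMono_sum_single {n : ℕ} (e : Fin n →₀ ℕ) :
    ∃ (k : ℕ) (α : Fin k → ℕ) (i : Fin k → Fin n), (∀ t, 0 < α t) ∧ StrictMono i ∧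
      e = ∑ t, Finsupp.single (i t) (α t) := by
  refine ⟨e.support.card, fun t => e (e.support.orderEmbOfFin rfl t),
    e.support.orderEmbOfFin rfl, fun t => ?_, (e.support.orderEmbOfFin rfl).strictMono, ?_⟩
  · exact Nat.pos_of_ne_zero (Finsupp.mem_support_iff.1 (Finset.orderEmbOfFin_mem _ _ _))
  · conv_lhs => rw [← Finsupp.sum_single e, Finsupp.sum,
      ← Finset.sum_coe_sort e.support fun a => Finsupp.single a (e a)]
    exact ((e.support.orderIsoOfFin rfl).toEquiv.sum_comp fun a : e.support =>
      Finsupp.single (a : Fin n) (e a)).symm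

theorem mapDomain_sum_single {ι σ τ M : Type*} [Fintype ι] [AddCommMonoid M] (p : σ → τ)
    (i : ι → σ) (α : ι → M) :
    (∑ t, Finsupp.single (i t) (α t)).mapDomain p = ∑ t, Finsupp.single (p (i t)) (α t) := by
  simp only [Finsupp.mapDomain_finsetSum, Finsupp.mapDomain_single]

theorem eq_of_strictMono_fin {n : ℕ} {i j : Fin n → Fin n} (hi : StrictMono i)
    (hj : StrictMono j) : i = j :=
  hi.range_inj hj |>.1 <| by
    rw [(Finite.surjective_of_injective hi.injective).range_eq,
      (Finite.surjective_of_injective hj.injective).range_eq]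

theorem exists_eq_succAbove_comp {n k : ℕ} {i : Fin k → Fin (n + 1)} (hi : StrictMono i)
    (hk : k ≠ n + 1) :
    ∃ (p : Fin (n + 1)) (i' : Fin k → Fin n), StrictMono i' ∧ i = p.succAbove ∘ i' := by
  have hs : ¬ Function.Surjective i := fun hs =>
    hk (by simpa using Fintype.card_of_bijective ⟨hi.injective, hs⟩)
  simp only [Function.Surjective, not_forall, not_exists] at hs
  obtain ⟨p, hp⟩ := hs
  choose i' hi' using fun t => Fin.exists_succAbove_eq (hp t)
  refine ⟨p, i', fun s t hst => ?_, funext fun t => (hi' t).symm⟩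
  rw [← (Fin.strictMono_succAbove p).lt_iff_lt, hi', hi']
  exact hi hst

theorem isQuasisymmetric_iff_forall_omitVar_eq {n : ℕ} {f : MvPolynomial (Fin (n + 1)) ℚ} :
    IsQuasisymmetric f ↔ ∀ p q, omitVar p f = omitVar q f := by
  constructor
  · intro hf p q
    ext e
    obtain ⟨k, α, i, hα, hi, rfl⟩ := exists_strictMono_sum_single e
    simp only [coeff_omitVar, mapDomain_sum_single]
    exact hf k α _ _ hα ((Fin.strictMono_succAbove p).comp hi)
      ((Fin.strictMono_succAbove q).comp hi)
  · intro h
    induction n with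
    | zero =>
      intro k α i j _ _ _
      rw [show i = j from funext fun _ => Subsingleton.elim (α := Fin 1) _ _]
    | succ n ih =>
      have h0 : IsQuasisymmetric (omitVar 0 f) := ih fun p q => by
        rw [omitVar_omitVar_zero, omitVar_omitVar_zero, h p.succ q.succ]
      intro k α i j hα hi hj
      by_cases hk : k = n + 2
      · subst hk
        rw [eq_of_strictMono_fin hi hj]
      · obtain ⟨p, i', hi', rfl⟩ := exists_eq_succAbove_comp hi hk
        obtain ⟨q, j', hj', rfl⟩ := exists_eq_succAbove_comp hj hk
        simp only [Function.comp_apply, ← mapDomain_sum_single p.succAbove,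
          ← mapDomain_sum_single q.succAbove, ← coeff_omitVar, h p 0, h q 0]
        exact h0 k α _ _ hα hi' hj'

theorem IsQuasisymmetric.trim_eq_zero {n : ℕ} {f : MvPolynomial (Fin (n + 1)) ℚ}
    (hf : IsQuasisymmetric f) (i : Fin n) : trim i f = 0 :=
  (trim_eq_zero_iff i f).2 (isQuasisymmetric_iff_forall_omitVar_eq.1 hf _ _)

theorem IsQuasisymmetric.omitVar {n : ℕ} {f : MvPolynomial (Fin (n + 1)) ℚ}
    (hf : IsQuasisymmetric f) (p : Fin (n + 1)) : IsQuasisymmetric (omitVar p f) := by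
  intro k α i j hα hi hj
  simp only [coeff_omitVar, mapDomain_sum_single]
  exact hf k α _ _ hα ((Fin.strictMono_succAbove p).comp hi) ((Fin.strictMono_succAbove p).comp hj)

theorem IsQuasisymmetric.homogeneousComponent {n : ℕ} {f : MvPolynomial (Fin n) ℚ}
    (hf : IsQuasisymmetric f) (d : ℕ) : IsQuasisymmetric (homogeneousComponent d f) := by
  intro k α i j hα hi hj
  simp only [coeff_homogeneousComponent, map_sum, Finsupp.degree_single, hf k α i j hα hi hj]

theorem omitVar_mem_qsymIdeal {n : ℕ} (i : Fin (n + 1)) {f : MvPolynomial (Fin (n + 1)) ℚ}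
    (hf : f ∈ qsymIdeal (n + 1)) : omitVar i f ∈ qsymIdeal n := by
  have h : qsymIdeal (n + 1) ≤ (qsymIdeal n).comap (omitVar i) :=
    Ideal.span_le.2 fun g hg => Ideal.subset_span
      ⟨hg.1.omitVar i, (constantCoeff_omitVar i g).trans hg.2⟩
  exact h hf

theorem trim_mem_qsymIdeal {n : ℕ} (i : Fin n) {f : MvPolynomial (Fin (n + 1)) ℚ}
    (hf : f ∈ qsymIdeal (n + 1)) : trim i f ∈ qsymIdeal n := by
  induction hf using Submodule.span_induction with
  | mem g hg => rw [hg.1.trim_eq_zero]; exact zero_mem _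
  | zero => rw [map_zero]; exact zero_mem _
  | add f g _ _ hf hg => rw [map_add]; exact add_mem hf hg
  | smul p f hmem hf =>
    rw [smul_eq_mul, trim_mul]
    exact add_mem (Ideal.mul_mem_left _ _ (omitVar_mem_qsymIdeal _ hmem))
      (Ideal.mul_mem_left _ _ hf)

theorem constantCoeff_eq_zero_of_mem_qsymIdeal {n : ℕ} {f : MvPolynomial (Fin n) ℚ}
    (hf : f ∈ qsymIdeal n) : constantCoeff f = 0 := by
  have h : qsymIdeal n ≤ RingHom.ker (constantCoeff (R := ℚ) (σ := Fin n)) :=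
    Ideal.span_le.2 fun g hg => hg.2
  exact h hf

attribute [local instance] MvPolynomial.gradedAlgebra in
theorem homogeneousComponent_mem_qsymIdeal {n : ℕ} {f : MvPolynomial (Fin n) ℚ}
    (hf : f ∈ qsymIdeal n) (d : ℕ) : homogeneousComponent d f ∈ qsymIdeal n := by
  let Q : Set (MvPolynomial (Fin n) ℚ) :=
    {g | IsQuasisymmetric g ∧ constantCoeff g = 0 ∧ ∃ d, g.IsHomogeneous d}
  have hspan : qsymIdeal n = Ideal.span Q := by
    refine le_antisymm (Ideal.span_le.2 fun g hg => ?_)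
      (Ideal.span_mono fun g hg => ⟨hg.1, hg.2.1⟩)
    rw [← sum_homogeneousComponent g]
    refine sum_mem fun d _ => Ideal.subset_span
      ⟨hg.1.homogeneousComponent d, ?_, d, homogeneousComponent_isHomogeneous d g⟩
    rw [constantCoeff_eq, coeff_homogeneousComponent, ← constantCoeff_eq, hg.2, ite_self]
  rw [hspan] at hf ⊢
  exact homogeneousComponent_mem_of_mem (Ideal.homogeneous_span _ _ fun g hg => hg.2.2) hf d

/-! ### Bounded excess and uniqueness of the reduction -/

/-- Exponent vectors `d` with `d_k + d_{k-1} + ⋯ + d_{k+1-j} < j + t` for `j = 1, …, k`. For `t = 0`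
these are the ABB vectors; larger `t` are needed for induction on the number of variables. -/
def excessVectors (k t : ℕ) : Set (Fin k →₀ ℕ) :=
  {d | ∀ i : Fin k, ∑ j ∈ Finset.Ici i, d j + i < k + t}

theorem abbVectors_eq_excessVectors (n : ℕ) : abbVectors n = excessVectors n 0 := by
  have hsum (d : Fin n →₀ ℕ) (i : Fin n) :
      ∑ j ∈ Finset.Iic i, d j.rev = ∑ j ∈ Finset.Ici i.rev, d j :=
    Finset.sum_nbij' Fin.rev Fin.rev (by simp) (by simp [Fin.rev_le_iff]) (by simp) (by simp)
      (by simp)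
  ext d
  simp only [abbVectors, excessVectors, Set.mem_ofPred_eq, hsum]
  refine Fin.revPerm.forall_congr fun {i} => ?_
  rw [Fin.revPerm_apply, Fin.val_rev]
  omega

theorem abbSpan_eq_restrictSupport (n : ℕ) :
    abbSpan n = restrictSupport ℚ (excessVectors n 0) := by
  rw [abbSpan, abbVectors_eq_excessVectors, restrictSupport_eq_span]

theorem mem_restrictSupport_iff_coeff {σ R : Type*} [CommSemiring R] {s : Set (σ →₀ ℕ)}
    {f : MvPolynomial σ R} : f ∈ restrictSupport R s ↔ ∀ d, coeff d f ≠ 0 → d ∈ s := by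
  simp only [mem_restrictSupport_iff, Set.subset_def, Finset.mem_coe, ← mem_support_iff]

theorem sum_mapDomain {σ τ M : Type*} [Fintype σ] [DecidableEq τ] [AddCommMonoid M] (p : σ → τ)
    (a : σ →₀ M) (s : Finset τ) : ∑ j ∈ s, a.mapDomain p j = ∑ i with p i ∈ s, a i := by
  simp only [Finsupp.mapDomain, Finsupp.sum_fintype, Finsupp.single_zero, implies_true,
    Finsupp.finsetSum_apply, Finsupp.single_apply]
  rw [Finset.sum_comm, Finset.sum_filter]
  simp only [Finset.sum_ite_eq]

theorem sum_Ici_le_sum_Ici_mapDomain {k n : ℕ} {p : Fin k → Fin n} {l : Fin k} {m : Fin n}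
    (hp : ∀ j, l ≤ j → m ≤ p j) (a : Fin k →₀ ℕ) :
    ∑ j ∈ Finset.Ici l, a j ≤ ∑ j ∈ Finset.Ici m, a.mapDomain p j := by
  rw [sum_mapDomain]
  exact Finset.sum_le_sum_of_subset fun j hj => by simpa using hp j (Finset.mem_Ici.1 hj)

theorem castSucc_le_succAbove {n : ℕ} (p : Fin (n + 1)) (j : Fin n) :
    j.castSucc ≤ p.succAbove j := by
  rw [Fin.succAbove]
  split_ifs
  exacts [le_rfl, Fin.castSucc_lt_succ.le]

theorem mem_excessVectors_of_mapDomain {n t : ℕ} {i : Fin n} {p : Fin (n + 1)} {e : Fin n →₀ ℕ}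
    (hpi : p ≤ i.succ)
    (h : (Finsupp.single i 1 + e).mapDomain p.succAbove ∈ excessVectors (n + 1) t) :
    e ∈ excessVectors n t := by
  intro l
  have hadd : ∑ j ∈ Finset.Ici l, (Finsupp.single i 1 + e : Fin n →₀ ℕ) j =
      ∑ j ∈ Finset.Ici l, Finsupp.single i 1 j + ∑ j ∈ Finset.Ici l, e j :=
    Finset.sum_add_distrib
  rcases le_or_gt l i with hl | hl
  · have hsum := sum_Ici_le_sum_Ici_mapDomain (p := p.succAbove) (m := l.castSucc)
      (fun j hj => (Fin.castSucc_le_castSucc_iff.2 hj).trans (castSucc_le_succAbove p j))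
      (Finsupp.single i 1 + e)
    have hone : 1 ≤ ∑ j ∈ Finset.Ici l, Finsupp.single i 1 j :=
      (Finsupp.single_eq_same (M := ℕ)).ge.trans
        (Finset.single_le_sum (fun _ _ => Nat.zero_le _) (Finset.mem_Ici.2 hl))
    have hlt := h l.castSucc
    rw [Fin.val_castSucc] at hlt
    omega
  · have hsum := sum_Ici_le_sum_Ici_mapDomain (p := p.succAbove) (m := l.succ)
      (fun j hj => by
        rw [Fin.succAbove_of_le_castSucc _ _
          (hpi.trans (Fin.succ_le_castSucc_iff.2 (hl.trans_le hj)))]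
        exact Fin.succ_le_succ_iff.2 hj)
      (Finsupp.single i 1 + e)
    have hlt := h l.succ
    rw [Fin.val_succ] at hlt
    omega

theorem trim_mem_restrictSupport {R : Type*} [CommRing R] {n t : ℕ} (i : Fin n)
    {f : MvPolynomial (Fin (n + 1)) R} (hf : f ∈ restrictSupport R (excessVectors (n + 1) t)) :
    trim i f ∈ restrictSupport R (excessVectors n t) := by
  rw [mem_restrictSupport_iff_coeff] at hf ⊢
  intro e he
  rw [coeff_trim] at he
  by_cases h : coeff ((Finsupp.single i 1 + e).mapDomain i.succ.succAbove) f = 0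
  · rw [h, zero_sub, neg_ne_zero] at he
    exact mem_excessVectors_of_mapDomain Fin.castSucc_lt_succ.le (hf _ he)
  · exact mem_excessVectors_of_mapDomain le_rfl (hf _ h)

theorem trim_mem_abbSpan {n : ℕ} (i : Fin n) {f : MvPolynomial (Fin (n + 1)) ℚ}
    (hf : f ∈ abbSpan (n + 1)) : trim i f ∈ abbSpan n := by
  rw [abbSpan_eq_restrictSupport] at hf ⊢
  exact trim_mem_restrictSupport i hf

theorem mem_abbVectors_of_coeff_ne_zero {n : ℕ} {f : MvPolynomial (Fin n) ℚ} (hf : f ∈ abbSpan n)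
    {d : Fin n →₀ ℕ} (hd : coeff d f ≠ 0) : d ∈ abbVectors n := by
  rw [abbSpan_eq_restrictSupport, ← abbVectors_eq_excessVectors] at hf
  exact mem_restrictSupport_iff_coeff.1 hf d hd

theorem apply_last_eq_zero_of_mem_abbVectors {n : ℕ} {d : Fin (n + 1) →₀ ℕ}
    (hd : d ∈ abbVectors (n + 1)) : d (Fin.last n) = 0 := by
  have h := hd 0
  rwa [show Finset.Iic (0 : Fin (n + 1)) = {0} from Finset.Iic_bot, Finset.sum_singleton,
    Fin.rev_zero, Fin.val_zero, Nat.le_zero] at h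

theorem IsQuasisymmetric.eq_zero_of_mem_abbSpan {n : ℕ} {f : MvPolynomial (Fin (n + 1)) ℚ}
    (hf : IsQuasisymmetric f) (habb : f ∈ abbSpan (n + 1)) (h0 : constantCoeff f = 0) :
    f = 0 := by
  ext d
  rw [coeff_zero]
  by_contra hd
  obtain ⟨k, α, i, hα, hi, rfl⟩ := exists_strictMono_sum_single d
  obtain _ | k := k
  · exact hd (by simpa [constantCoeff_eq] using h0)
  -- Push the indices as far right as possible, so that the last variable occurs.
  have hk : k + 1 ≤ n + 1 := by simpa using Fintype.card_le_of_injective i hi.injective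
  let j : Fin (k + 1) → Fin (n + 1) := fun t => (Fin.castLE hk t.rev).rev
  have hj : StrictMono j := fun s t hst => by
    simpa only [j, Fin.rev_lt_rev, Fin.castLE_lt_castLE_iff] using hst
  have hlast : j (Fin.last k) = Fin.last n := by simp [j]
  rw [hf (k + 1) α i j hα hi hj] at hd
  have hzero := apply_last_eq_zero_of_mem_abbVectors (mem_abbVectors_of_coeff_ne_zero habb hd)
  rw [Finsupp.finsetSum_apply, Finset.sum_eq_zero_iff] at hzero
  have hαk := hzero (Fin.last k) (Finset.mem_univ _)
  rw [hlast, Finsupp.single_eq_same] at hαk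
  exact (hα _).ne' hαk

theorem isQuasisymmetric_of_forall_trim_eq_zero {n : ℕ} {f : MvPolynomial (Fin (n + 1)) ℚ}
    (hf : ∀ i, trim i f = 0) : IsQuasisymmetric f := by
  have h0 (p : Fin (n + 1)) : omitVar p f = omitVar 0 f := by
    induction p using Fin.induction with
    | zero => rfl
    | succ i ih => rw [(trim_eq_zero_iff i f).1 (hf i), ih]
  exact isQuasisymmetric_iff_forall_omitVar_eq.2 fun p q => (h0 p).trans (h0 q).symm

theorem disjoint_abbSpan_qsymIdeal (n : ℕ) :
    Disjoint (abbSpan n) ((qsymIdeal n).restrictScalars ℚ) := by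
  rw [Submodule.disjoint_def]
  intro f habb hqsym
  induction n with
  | zero =>
    rw [eq_C_of_isEmpty f, ← constantCoeff_eq, constantCoeff_eq_zero_of_mem_qsymIdeal hqsym,
      map_zero]
  | succ n ih =>
    have htrim (i : Fin n) : trim i f = 0 :=
      ih _ (trim_mem_abbSpan i habb) (trim_mem_qsymIdeal i hqsym)
    exact (isQuasisymmetric_of_forall_trim_eq_zero htrim).eq_zero_of_mem_abbSpan habb
      (constantCoeff_eq_zero_of_mem_qsymIdeal hqsym)

theorem IsABBReduction.unique {n : ℕ} {f r r' : MvPolynomial (Fin n) ℚ} (h : IsABBReduction f r)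
    (h' : IsABBReduction f r') : r = r' := by
  refine sub_eq_zero.1 (Submodule.disjoint_def.1 (disjoint_abbSpan_qsymIdeal n) _
    (sub_mem h.1 h'.1) ?_)
  rw [← sub_sub_sub_cancel_left r' r f]
  exact sub_mem h'.2 h.2

theorem IsABBReduction.homogeneousComponent {n : ℕ} {f r : MvPolynomial (Fin n) ℚ}
    (h : IsABBReduction f r) (d : ℕ) :
    IsABBReduction (homogeneousComponent d f) (homogeneousComponent d r) := by
  refine ⟨?_, by rw [← map_sub]; exact homogeneousComponent_mem_qsymIdeal h.2 d⟩
  have hr := h.1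
  rw [abbSpan_eq_restrictSupport, mem_restrictSupport_iff_coeff] at hr ⊢
  intro e he
  rw [coeff_homogeneousComponent] at he
  exact hr e (ite_ne_right_iff.1 he).2

theorem IsABBReduction.isHomogeneous {n d : ℕ} {f r : MvPolynomial (Fin n) ℚ}
    (h : IsABBReduction f r) (hf : f.IsHomogeneous d) : r.IsHomogeneous d := by
  have hd := h.homogeneousComponent d
  rw [homogeneousComponent_eq_self hf] at hd
  exact hd.unique h ▸ homogeneousComponent_isHomogeneous d r

/-! ### The coefficient sum of the reduction in top degree -/

section TrimSum

variable {R : Type*} [CommRing R]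

variable (R) in
/-- The linear functional `(trim_0 + ⋯ + trim_{n-1})^n` followed by the constant coefficient. It
extracts the sum of the coefficients of the reduction of a polynomial of degree `n`. -/
noncomputable def trimSum : (n : ℕ) → MvPolynomial (Fin (n + 1)) R →ₗ[R] R
  | 0 => lcoeff R 0
  | n + 1 => trimSum n ∘ₗ ∑ i : Fin (n + 1), trim i

theorem trimSum_succ {n : ℕ} (f : MvPolynomial (Fin (n + 2)) R) :
    trimSum R (n + 1) f = ∑ i : Fin (n + 1), trimSum R n (trim i f) := by
  rw [trimSum, LinearMap.comp_apply, LinearMap.sum_apply, map_sum]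

theorem omitVar_eq_zero {n : ℕ} {p : Fin (n + 1)} {f : MvPolynomial (Fin (n + 1)) R}
    (hf : ∀ d, coeff d f ≠ 0 → d p ≠ 0) : omitVar p f = 0 := by
  ext e
  rw [coeff_omitVar, coeff_zero]
  by_contra he
  exact hf _ he (Finsupp.mapDomain_of_notMem_range _ _ (by simp))

theorem eval_one_omitVar {n : ℕ} {p : Fin (n + 1)} {f : MvPolynomial (Fin (n + 1)) R}
    (hf : ∀ d, coeff d f ≠ 0 → d p = 0) : eval 1 (omitVar p f) = eval 1 f := by
  obtain ⟨g, rfl⟩ : ∃ g, rename p.succAbove g = f := by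
    refine exists_rename_eq_of_vars_subset_range f _ Fin.succAbove_right_injective fun j hj => ?_
    obtain ⟨d, hd, hdj⟩ := (mem_vars_iff_mem_support j).1 (Finset.mem_coe.1 hj)
    rw [Fin.range_succAbove, Set.mem_compl_singleton_iff]
    rintro rfl
    exact Finsupp.mem_support_iff.1 hdj (hf d (mem_support_iff.1 hd))
  rw [omitVar_rename_succAbove, eval_rename, Pi.one_comp]

theorem eval_one_sum_trim {n : ℕ} (f : MvPolynomial (Fin (n + 1)) R) :
    eval 1 (∑ i, trim i f) = eval 1 (omitVar (Fin.last n) f) - eval 1 (omitVar 0 f) := by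
  have htrim (i : Fin n) :
      eval 1 (trim i f) = eval 1 (omitVar i.succ f) - eval 1 (omitVar i.castSucc f) := by
    rw [← map_sub, ← X_mul_trim, map_mul, eval_X, Pi.one_apply, one_mul]
  rw [map_sum, Finset.sum_congr rfl fun i _ => htrim i, Finset.sum_sub_distrib,
    sub_eq_sub_iff_add_eq_add, add_comm,
    ← Fin.sum_univ_succ fun p => eval 1 (omitVar p f), Fin.sum_univ_castSucc, add_comm]

theorem isHomogeneous_trim {n m : ℕ} {f : MvPolynomial (Fin (n + 1)) R}
    (hf : f.IsHomogeneous (m + 1)) (i : Fin n) : (trim i f).IsHomogeneous m := by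
  intro e he
  rw [Pi.one_def, ← Finsupp.degree_eq_weight_one]
  by_contra hdeg
  have hcoeff (p : Fin (n + 1)) :
      coeff ((Finsupp.single i 1 + e).mapDomain p.succAbove) f = 0 :=
    hf.coeff_eq_zero (by
      rw [Finsupp.degree_mapDomain, map_add, Finsupp.degree_single]
      omega)
  exact he (by rw [coeff_trim, hcoeff, hcoeff, sub_zero])

end TrimSum

theorem apply_zero_ne_zero_of_mem_abbVectors {n : ℕ} {d : Fin (n + 2) →₀ ℕ}
    (hd : d ∈ abbVectors (n + 2)) (hdeg : d.degree = n + 1) : d 0 ≠ 0 := by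
  intro h0
  rw [abbVectors_eq_excessVectors] at hd
  have hlt := hd 1
  rw [Finset.sum_subset (Finset.subset_univ _) fun j _ hj => ?_, ← Finsupp.degree_eq_sum, hdeg,
    Fin.val_one] at hlt
  · omega
  · rw [Finset.mem_Ici, not_le, Fin.lt_one_iff] at hj
    rw [hj, h0]

theorem eval_one_sum_trim_of_mem_abbSpan {n : ℕ} {f : MvPolynomial (Fin (n + 2)) ℚ}
    (hf : f ∈ abbSpan (n + 2)) (hdeg : f.IsHomogeneous (n + 1)) :
    eval 1 (∑ i, trim i f) = eval 1 f := by
  have hlast (d) (hd : coeff d f ≠ 0) : d (Fin.last (n + 1)) = 0 :=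
    apply_last_eq_zero_of_mem_abbVectors (mem_abbVectors_of_coeff_ne_zero hf hd)
  have hzero (d) (hd : coeff d f ≠ 0) : d 0 ≠ 0 :=
    apply_zero_ne_zero_of_mem_abbVectors (mem_abbVectors_of_coeff_ne_zero hf hd)
      (by_contra fun h => hd (hdeg.coeff_eq_zero h))
  rw [eval_one_sum_trim, eval_one_omitVar hlast, omitVar_eq_zero hzero, map_zero, sub_zero]

theorem trimSum_eq_zero {n : ℕ} {f : MvPolynomial (Fin (n + 1)) ℚ} (hf : f ∈ qsymIdeal (n + 1)) :
    trimSum ℚ n f = 0 := by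
  induction n with
  | zero => exact constantCoeff_eq_zero_of_mem_qsymIdeal hf
  | succ n ih =>
    rw [trimSum_succ]
    exact Finset.sum_eq_zero fun i _ => ih (trim_mem_qsymIdeal i hf)

theorem trimSum_eq_eval_one {n : ℕ} {f : MvPolynomial (Fin (n + 1)) ℚ}
    (hf : f ∈ abbSpan (n + 1)) (hdeg : f.IsHomogeneous n) : trimSum ℚ n f = eval 1 f := by
  induction n with
  | zero =>
    rw [totalDegree_eq_zero_iff_eq_C.1 (Nat.le_zero.1 hdeg.totalDegree_le), eval_C, trimSum,
      lcoeff_apply, coeff_C, if_pos rfl]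
  | succ n ih =>
    rw [trimSum_succ, ← map_sum, ih (sum_mem fun i _ => trim_mem_abbSpan i hf)
      (IsHomogeneous.sum _ _ _ fun i _ => isHomogeneous_trim hdeg i),
      eval_one_sum_trim_of_mem_abbSpan hf hdeg]

theorem IsABBReduction.eval_one_eq_trimSum {n : ℕ} {f r : MvPolynomial (Fin (n + 1)) ℚ}
    (h : IsABBReduction f r) (hf : f.IsHomogeneous n) : eval 1 r = trimSum ℚ n f := by
  rw [← trimSum_eq_eval_one h.1 (h.isHomogeneous hf), eq_comm, ← sub_eq_zero, ← map_sub]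
  exact trimSum_eq_zero h.2

/-! ### Existence of the reduction -/

section Existence

variable {R : Type*} [CommRing R] {k t : ℕ}

theorem omitVar_castSucc_rename_castSucc (i : Fin (k + 1)) (f : MvPolynomial (Fin (k + 1)) R) :
    omitVar i.castSucc (rename Fin.castSucc f) = rename Fin.castSucc (omitVar i f) := by
  induction f using MvPolynomial.induction_on with
  | C a => simp only [algHom_C, algebraMap_eq]
  | add f g hf hg => simp only [map_add, hf, hg]
  | mul_X f j hf =>
    rw [map_mul, map_mul, hf, map_mul, map_mul, rename_X]
    obtain rfl | ⟨j, rfl⟩ := Fin.eq_self_or_eq_succAbove i j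
    · simp only [omitVar_X_self, map_zero]
    · rw [← Fin.castSucc_succAbove_castSucc, omitVar_X_succAbove, omitVar_X_succAbove, rename_X]

@[simp] theorem omitVar_last_rename_castSucc (f : MvPolynomial (Fin k) R) :
    omitVar (Fin.last k) (rename Fin.castSucc f) = f := by
  rw [← Fin.succAbove_last, omitVar_rename_succAbove]

@[simp] theorem omitVar_castSucc_X_last (i : Fin (k + 1)) :
    omitVar i.castSucc (X (Fin.last (k + 1)) : MvPolynomial _ R) = X (Fin.last k) := by
  rw [← Fin.succ_last, ← Fin.succAbove_castSucc_of_le i (Fin.last k) (Fin.le_last i),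
    omitVar_X_succAbove]

variable (R) in
/-- Gessel's fundamental quasisymmetric polynomial: the sum of the monomials `x_{i_1} ⋯ x_{i_N}`
with `i_1 ≥ ⋯ ≥ i_N` and `i_j > i_{j+1}` whenever the `j`-th letter of the word is `true`. The last
letter is irrelevant; it makes the recursion on words uniform. -/
noncomputable def fundamental : (k : ℕ) → List Bool → MvPolynomial (Fin k) R
  | _, [] => 1
  | 0, _ :: _ => 0
  | k + 1, false :: w =>
    rename Fin.castSucc (fundamental k (false :: w)) + X (Fin.last k) * fundamental (k + 1) w
  | k + 1, true :: w =>
    rename Fin.castSucc (fundamental k (true :: w)) +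
      X (Fin.last k) * rename Fin.castSucc (fundamental k w)

theorem omitVar_last_fundamental (k : ℕ) (w : List Bool) :
    omitVar (Fin.last k) (fundamental R (k + 1) w) = fundamental R k w := by
  rcases w with _ | ⟨_ | _, w⟩
  · rw [fundamental, map_one, fundamental]
  all_goals rw [fundamental, map_add, map_mul, omitVar_X_self, zero_mul, add_zero,
    omitVar_last_rename_castSucc]

theorem omitVar_fundamental (i : Fin (k + 1)) (w : List Bool) :
    omitVar i (fundamental R (k + 1) w) = fundamental R k w := by
  induction k generalizing w with
  | zero => rw [show i = Fin.last 0 from Fin.fin_one_eq_zero i, omitVar_last_fundamental]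
  | succ k ihk =>
    cases i using Fin.lastCases with
    | last => exact omitVar_last_fundamental (k + 1) w
    | cast i =>
      induction w with
      | nil => rw [fundamental, map_one, fundamental]
      | cons b w ihw =>
        cases b
        · rw [fundamental, map_add, map_mul, ihw, omitVar_castSucc_rename_castSucc, ihk,
            omitVar_castSucc_X_last, fundamental]
        · rw [fundamental, map_add, map_mul, omitVar_castSucc_rename_castSucc,
            omitVar_castSucc_rename_castSucc, ihk, ihk, omitVar_castSucc_X_last, fundamental]

theorem constantCoeff_fundamental {w : List Bool} (hw : w ≠ []) :
    constantCoeff (fundamental R k w) = 0 := by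
  obtain ⟨b, w, rfl⟩ := List.exists_cons_of_ne_nil hw
  induction k with
  | zero => simp only [fundamental, map_zero]
  | succ k ih => cases b <;> simp [fundamental, constantCoeff_rename, ih]

theorem isQuasisymmetric_fundamental (k : ℕ) (w : List Bool) :
    IsQuasisymmetric (fundamental ℚ k w) := by
  cases k with
  | zero =>
    intro _ _ i j _ _ _
    rw [Subsingleton.elim i j]
  | succ k =>
    exact isQuasisymmetric_iff_forall_omitVar_eq.2 fun p q => by
      rw [omitVar_fundamental, omitVar_fundamental]

variable (R) in
/-- The ideal modulo which every monomial reduces to monomials with exponents in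
`excessVectors k t`. -/
noncomputable def excessIdeal (k t : ℕ) : Ideal (MvPolynomial (Fin k) R) :=
  Ideal.span {f | ∃ w : List Bool, t < w.count false ∧ fundamental R k w = f}

theorem fundamental_mem_excessIdeal {w : List Bool} (hw : t < w.count false) :
    fundamental R k w ∈ excessIdeal R k t :=
  Ideal.subset_span ⟨w, hw, rfl⟩

theorem excessIdeal_le_qsymIdeal (k t : ℕ) : excessIdeal ℚ k t ≤ qsymIdeal k := by
  refine Ideal.span_mono ?_
  rintro _ ⟨w, hw, rfl⟩
  refine ⟨isQuasisymmetric_fundamental k w, constantCoeff_fundamental ?_⟩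
  rintro rfl
  exact Nat.not_lt_zero _ hw

theorem rename_fundamental_mem_excessIdeal {w : List Bool} (hw : t + 1 < w.count false) :
    rename Fin.castSucc (fundamental R k w) ∈ excessIdeal R (k + 1) t := by
  induction w with
  | nil => exact absurd hw (Nat.not_lt_zero _)
  | cons b w ih =>
    have hmem : fundamental R (k + 1) (b :: w) ∈ excessIdeal R (k + 1) t :=
      fundamental_mem_excessIdeal ((Nat.lt_succ_self t).trans hw)
    cases b with
    | false =>
      rw [List.count_cons_self, Nat.add_lt_add_iff_right] at hw
      rw [fundamental] at hmem
      exact (Ideal.add_mem_iff_left _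
        (Ideal.mul_mem_left _ _ (fundamental_mem_excessIdeal hw))).1 hmem
    | true =>
      rw [List.count_cons_of_ne (by decide)] at hw
      rw [fundamental] at hmem
      exact (Ideal.add_mem_iff_left _ (Ideal.mul_mem_left _ _ (ih hw))).1 hmem

theorem fundamental_replicate_append (e : ℕ) (w : List Bool) :
    fundamental R (k + 1) (List.replicate e false ++ w) =
      ∑ i ∈ Finset.range e, X (Fin.last k) ^ i *
          rename Fin.castSucc (fundamental R k (List.replicate (e - i) false ++ w)) +
        X (Fin.last k) ^ e * fundamental R (k + 1) w := by
  induction e with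
  | zero => simp
  | succ e ih =>
    rw [List.replicate_succ, List.cons_append, fundamental, ih, Finset.sum_range_succ', mul_add,
      Finset.mul_sum]
    simp only [Nat.add_sub_add_right, Nat.sub_zero, pow_zero, one_mul, pow_succ', mul_assoc,
      List.replicate_succ, List.cons_append]
    ring

section Submodule

variable {N : Submodule R (MvPolynomial (Fin (k + 1)) R)} {e : ℕ}

theorem X_last_pow_mul_fundamental_mem (hN : ∀ f ∈ excessIdeal R (k + 1) t, f ∈ N)
    (hlower : ∀ i < e, ∀ f, X (Fin.last k) ^ i * rename Fin.castSucc f ∈ N) {w : List Bool}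
    (hw : t < e + w.count false) (f : MvPolynomial (Fin k) R) :
    X (Fin.last k) ^ e * (rename Fin.castSucc f * fundamental R (k + 1) w) ∈ N := by
  have hmem : rename Fin.castSucc f * fundamental R (k + 1) (List.replicate e false ++ w) ∈ N :=
    hN _ (Ideal.mul_mem_left _ _ (fundamental_mem_excessIdeal (by
      rwa [List.count_append, List.count_replicate_self])))
  rw [fundamental_replicate_append, mul_add, Finset.mul_sum, Submodule.add_mem_iff_right] at hmem
  · rwa [mul_left_comm]
  · refine sum_mem fun i hi => ?_
    rw [mul_left_comm, ← map_mul]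
    exact hlower i (Finset.mem_range.1 hi) _

theorem X_last_pow_mul_rename_mem_of_lt (hN : ∀ f ∈ excessIdeal R (k + 1) t, f ∈ N)
    (hlower : ∀ i < e, ∀ f, X (Fin.last k) ^ i * rename Fin.castSucc f ∈ N) (he : t < e)
    (f : MvPolynomial (Fin k) R) : X (Fin.last k) ^ e * rename Fin.castSucc f ∈ N := by
  simpa [fundamental] using X_last_pow_mul_fundamental_mem hN hlower (w := []) he f

theorem X_last_pow_mul_rename_mem_of_mem_excessIdeal (hN : ∀ f ∈ excessIdeal R (k + 1) t, f ∈ N)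
    (hlower : ∀ i < e, ∀ f, X (Fin.last k) ^ i * rename Fin.castSucc f ∈ N)
    {f : MvPolynomial (Fin k) R} (hf : f ∈ excessIdeal R k (t + 1 - e)) :
    X (Fin.last k) ^ e * rename Fin.castSucc f ∈ N := by
  suffices ∀ p, X (Fin.last k) ^ e * rename Fin.castSucc (p * f) ∈ N by simpa using this 1
  induction hf using Submodule.span_induction with
  | mem f hf =>
    obtain ⟨w, hw, rfl⟩ := hf
    intro p
    rw [map_mul]
    cases e with
    | zero =>
      exact hN _ (Ideal.mul_mem_left _ _ (Ideal.mul_mem_left _ _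
        (rename_fundamental_mem_excessIdeal hw)))
    | succ e =>
      have hsum := X_last_pow_mul_fundamental_mem hN
        (fun i hi => hlower i (hi.trans e.lt_succ_self))
        (w := true :: w) (by rw [List.count_cons_of_ne (by decide)]; omega) p
      rw [fundamental, mul_add, mul_add, ← map_mul,
        Submodule.add_mem_iff_right _ (hlower e e.lt_succ_self _), mul_left_comm _ (X _),
        ← mul_assoc, ← pow_succ] at hsum
      exact hsum
  | zero => simp
  | add f g _ _ hf hg =>
    intro p
    rw [mul_add, map_add, mul_add]
    exact add_mem (hf p) (hg p)
  | smul q f _ hf =>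
    intro p
    rw [smul_eq_mul, ← mul_assoc]
    exact hf (p * q)

end Submodule

theorem mapDomain_castSucc_add_single_mem_excessVectors {e : ℕ} (he : e ≤ t) {d : Fin k →₀ ℕ}
    (hd : d ∈ excessVectors k (t + 1 - e)) :
    d.mapDomain Fin.castSucc + Finsupp.single (Fin.last k) e ∈ excessVectors (k + 1) t := by
  intro l
  have hadd : ∑ j ∈ Finset.Ici l,
        (d.mapDomain Fin.castSucc + Finsupp.single (Fin.last k) e : Fin (k + 1) →₀ ℕ) j =
      ∑ i with i.castSucc ∈ Finset.Ici l, d i + e := by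
    simp only [Finsupp.add_apply, Finset.sum_add_distrib, sum_mapDomain, add_right_inj]
    rw [Finset.sum_eq_single_of_mem _ (Finset.mem_Ici.2 (Fin.le_last l))
      fun j _ hj => Finsupp.single_eq_of_ne hj, Finsupp.single_eq_same]
  rw [hadd]
  cases l using Fin.lastCases with
  | last =>
    rw [Finset.filter_false_of_mem fun i _ => by simp, Finset.sum_empty,
      Fin.val_last]
    omega
  | cast l =>
    have hlt := hd l
    simp only [Finset.mem_Ici, Fin.castSucc_le_castSucc_iff, Fin.val_castSucc]
    rw [← Finset.filter_le_eq_Ici] at hlt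
    omega

theorem X_last_pow_mul_rename_mem_restrictSupport {e : ℕ} (he : e ≤ t)
    {f : MvPolynomial (Fin k) R} (hf : f ∈ restrictSupport R (excessVectors k (t + 1 - e))) :
    X (Fin.last k) ^ e * rename Fin.castSucc f ∈ restrictSupport R (excessVectors (k + 1) t) := by
  rw [f.as_sum, map_sum, Finset.mul_sum]
  refine sum_mem fun d hd => ?_
  rw [rename_monomial, X_pow_eq_monomial, monomial_mul, one_mul,
    add_comm (Finsupp.single _ _), monomial_mem_restrictSupport]
  exact Or.inl (mapDomain_castSucc_add_single_mem_excessVectors he (hf hd))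

theorem eq_top_of_forall_X_last_pow_mul_rename_mem {N : Submodule R (MvPolynomial (Fin (k + 1)) R)}
    (h : ∀ e f, X (Fin.last k) ^ e * rename Fin.castSucc f ∈ N) : N = ⊤ := by
  refine eq_top_iff.2 fun f _ => ?_
  rw [f.as_sum]
  refine sum_mem fun d _ => ?_
  have hsupport : ((d.erase (Fin.last k)).support : Set (Fin (k + 1))) ⊆
      Set.range Fin.castSucc := by
    rw [← Fin.succAbove_last, Fin.range_succAbove, Finsupp.support_erase, Finset.coe_erase]
    exact fun j hj => hj.2
  have hmem := h (d (Fin.last k))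
    (monomial ((d.erase (Fin.last k)).comapDomain _ (Fin.castSucc_injective k).injOn) (coeff d f))
  rwa [rename_monomial, Finsupp.mapDomain_comapDomain _ (Fin.castSucc_injective k) _ hsupport,
    X_pow_eq_monomial, monomial_mul, one_mul, Finsupp.single_add_erase] at hmem

theorem restrictSupport_excessVectors_sup_excessIdeal (k t : ℕ) :
    restrictSupport R (excessVectors k t) ⊔ (excessIdeal R k t).restrictScalars R = ⊤ := by
  induction k generalizing t with
  | zero =>
    rw [show excessVectors 0 t = Set.univ from Set.eq_univ_of_forall fun _ i => i.elim0,
      restrictSupport_univ, top_sup_eq]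
  | succ k ih =>
    set N := restrictSupport R (excessVectors (k + 1) t) ⊔
      (excessIdeal R (k + 1) t).restrictScalars R
    have hN : ∀ f ∈ excessIdeal R (k + 1) t, f ∈ N := fun f hf => Submodule.mem_sup_right hf
    refine eq_top_of_forall_X_last_pow_mul_rename_mem fun e => ?_
    induction e using Nat.strong_induction_on with
    | _ e hlower =>
      intro f
      rcases lt_or_ge t e with he | he
      · exact X_last_pow_mul_rename_mem_of_lt hN hlower he f
      · obtain ⟨g, hg, h, hh, rfl⟩ := Submodule.mem_sup.1 ((ih (t + 1 - e)).ge
          (Submodule.mem_top (x := f)))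
        rw [map_add, mul_add]
        exact add_mem (Submodule.mem_sup_left (X_last_pow_mul_rename_mem_restrictSupport he hg))
          (X_last_pow_mul_rename_mem_of_mem_excessIdeal hN hlower hh)

end Existence

theorem exists_isABBReduction {n : ℕ} (f : MvPolynomial (Fin n) ℚ) : ∃ r, IsABBReduction f r := by
  obtain ⟨r, hr, g, hg, rfl⟩ := Submodule.mem_sup.1
    ((restrictSupport_excessVectors_sup_excessIdeal n 0).ge (Submodule.mem_top (x := f)))
  refine ⟨r, (abbSpan_eq_restrictSupport n).ge hr, ?_⟩
  rw [add_sub_cancel_left]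
  exact excessIdeal_le_qsymIdeal n 0 hg

theorem existsUnique_isABBReduction {n : ℕ} (f : MvPolynomial (Fin n) ℚ) :
    ∃! r, IsABBReduction f r :=
  existsUnique_of_exists_of_unique (exists_isABBReduction f) fun _ _ h h' => h.unique h'

theorem isABBReduction_abbReduction {n : ℕ} (f : MvPolynomial (Fin n) ℚ) :
    IsABBReduction f (abbReduction f) := by
  have h := exists_isABBReduction f
  rw [abbReduction, dif_pos h]
  exact h.choose_spec

/-! ### Contracting the spot of the first car -/

section Block

variable {S T : Finset ℤ} {x y z l l' r r' i : ℤ}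

theorem coe_block (S : Finset ℤ) (x : ℤ) :
    (block S x : Set ℤ) = Set.ordConnectedComponent (S : Set ℤ) x := by
  ext y
  simp only [block, Finset.mem_coe, Finset.mem_filter, Set.mem_ordConnectedComponent,
    ← Finset.coe_uIcc, Finset.coe_subset]
  exact and_iff_right_of_imp fun h => h Finset.right_mem_uIcc

theorem mem_block_iff : y ∈ block S x ↔ ∀ z, min x y ≤ z → z ≤ max x y → z ∈ S := by
  rw [← Finset.mem_coe, coe_block, Set.mem_ordConnectedComponent]
  exact ⟨fun h z h₁ h₂ => h ⟨h₁, h₂⟩, fun h z hz => h z hz.1 hz.2⟩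

theorem mem_block_self_iff : x ∈ block S x ↔ x ∈ S := by
  rw [← Finset.mem_coe, coe_block, Set.self_mem_ordConnectedComponent, Finset.mem_coe]

theorem mem_block_comm : y ∈ block S x ↔ x ∈ block S y := by
  simp only [← Finset.mem_coe, coe_block]
  exact Set.mem_ordConnectedComponent_comm

theorem block_subset (S : Finset ℤ) (x : ℤ) : block S x ⊆ S := Finset.filter_subset _ _

theorem left_mem_of_mem_block (h : y ∈ block S x) : x ∈ S := block_subset S y (mem_block_comm.1 h)

theorem block_eq_of_mem (h : y ∈ block S x) : block S x = block S y := by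
  rw [← Finset.coe_inj, coe_block, coe_block]
  exact Set.ordConnectedComponent_eq (Set.mem_ordConnectedComponent.1
    (by rwa [← coe_block, Finset.mem_coe]))

theorem block_mono (hST : S ⊆ T) (x : ℤ) : block S x ⊆ block T x := fun _ h =>
  mem_block_iff.2 fun z h₁ h₂ => hST (mem_block_iff.1 h z h₁ h₂)

/-- `l` is the free spot just to the left of the interval of occupied spots that contains `x`. -/
structure IsLeftSpot (S : Finset ℤ) (x l : ℤ) : Prop where
  notMem : l ∉ S
  add_one_mem : l + 1 ∈ block S x

/-- `r` is the free spot just to the right of the interval of occupied spots that contains `x`. -/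
structure IsRightSpot (S : Finset ℤ) (x r : ℤ) : Prop where
  notMem : r ∉ S
  sub_one_mem : r - 1 ∈ block S x

theorem IsLeftSpot.lt (h : IsLeftSpot S x l) : l < x := by
  by_contra hlx
  exact h.notMem (mem_block_iff.1 h.add_one_mem l (by omega) (by omega))

theorem IsRightSpot.lt (h : IsRightSpot S x r) : x < r := by
  by_contra hxr
  exact h.notMem (mem_block_iff.1 h.sub_one_mem r (by omega) (by omega))

theorem IsLeftSpot.le (h : IsLeftSpot S x l) (h' : IsLeftSpot S x l') : l ≤ l' := by
  by_contra hl
  have := h.lt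
  exact h.notMem (mem_block_iff.1 h'.add_one_mem l (by omega) (by omega))

theorem IsRightSpot.le (h : IsRightSpot S x r) (h' : IsRightSpot S x r') : r ≤ r' := by
  by_contra hr
  have := h'.lt
  exact h'.notMem (mem_block_iff.1 h.sub_one_mem r' (by omega) (by omega))

theorem IsLeftSpot.of_mem_block (h : IsLeftSpot S x l) (hxy : y ∈ block S x) : IsLeftSpot S y l :=
  ⟨h.notMem, block_eq_of_mem hxy ▸ h.add_one_mem⟩

theorem IsRightSpot.of_mem_block (h : IsRightSpot S x r) (hxy : y ∈ block S x) :
    IsRightSpot S y r :=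
  ⟨h.notMem, block_eq_of_mem hxy ▸ h.sub_one_mem⟩

theorem IsLeftSpot.mem_block_insert (h : IsLeftSpot S x l) : x ∈ block (insert l S) l := by
  refine mem_block_iff.2 fun z h₁ h₂ => Finset.mem_insert.2 (or_iff_not_imp_left.2 fun hz => ?_)
  have := h.lt
  exact mem_block_iff.1 h.add_one_mem z (by omega) (by omega)

theorem IsRightSpot.mem_block_insert (h : IsRightSpot S x r) : x ∈ block (insert r S) r := by
  refine mem_block_iff.2 fun z h₁ h₂ => Finset.mem_insert.2 (or_iff_not_imp_left.2 fun hz => ?_)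
  have := h.lt
  exact mem_block_iff.1 h.sub_one_mem z (by omega) (by omega)

theorem isLeftSpot_min' (h : x ∈ S) :
    IsLeftSpot S x ((block S x).min' (block_nonempty h) - 1) := by
  have hM := Finset.min'_mem _ (block_nonempty h)
  have hle := Finset.min'_le (block S x)
  set M := (block S x).min' (block_nonempty h)
  have hMx := hle x (mem_block_self_iff.2 h)
  refine ⟨fun hmem => ?_, by rwa [sub_add_cancel]⟩
  have hM' : M - 1 ∈ block S x := mem_block_iff.2 fun z h₁ h₂ => by
    obtain rfl | hz := eq_or_ne z (M - 1)
    · exact hmem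
    · exact mem_block_iff.1 hM z (by omega) (by omega)
  linarith [hle _ hM']

theorem isRightSpot_max' (h : x ∈ S) :
    IsRightSpot S x ((block S x).max' (block_nonempty h) + 1) := by
  have hM := Finset.max'_mem _ (block_nonempty h)
  have hle := Finset.le_max' (block S x)
  set M := (block S x).max' (block_nonempty h)
  have hxM := hle x (mem_block_self_iff.2 h)
  refine ⟨fun hmem => ?_, by rwa [add_sub_cancel_right]⟩
  have hM' : M + 1 ∈ block S x := mem_block_iff.2 fun z h₁ h₂ => by
    obtain rfl | hz := eq_or_ne z (M + 1)
    · exact hmem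
    · exact mem_block_iff.1 hM z (by omega) (by omega)
  linarith [hle _ hM']

/-- The order embedding of the spots that misses exactly the spot `i`. -/
def skip (i s : ℤ) : ℤ := if s < i then s else s + 1

theorem skip_strictMono (i : ℤ) : StrictMono (skip i) := fun s t hst => by
  unfold skip
  split_ifs <;> omega

theorem skip_ne (i s : ℤ) : skip i s ≠ i := by
  unfold skip
  split_ifs <;> omega

theorem eq_or_exists_eq_skip (i z : ℤ) : z = i ∨ ∃ s, z = skip i s := by
  rcases lt_trichotomy z i with h | h | h
  · exact Or.inr ⟨z, by rw [skip, if_pos h]⟩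
  · exact Or.inl h
  · exact Or.inr ⟨z - 1, by rw [skip, if_neg (by omega), sub_add_cancel]⟩

/-- The set of occupied spots obtained from `S` by inserting a new occupied spot `i` and moving the
spots from `i` on to the right. -/
def expand (i : ℤ) (S : Finset ℤ) : Finset ℤ := insert i (S.image (skip i))

theorem self_mem_expand (i : ℤ) (S : Finset ℤ) : i ∈ expand i S := Finset.mem_insert_self _ _

@[simp] theorem skip_mem_expand {s : ℤ} : skip i s ∈ expand i S ↔ s ∈ S := by
  rw [expand, Finset.mem_insert, or_iff_right (skip_ne i s),
    (skip_strictMono i).injective.mem_finset_image]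

theorem sub_one_mem_expand : i - 1 ∈ expand i S ↔ i - 1 ∈ S := by
  have h := skip_mem_expand (i := i) (s := i - 1) (S := S)
  rwa [skip, if_pos (sub_one_lt i)] at h

theorem add_one_mem_expand : i + 1 ∈ expand i S ↔ i ∈ S := by
  have h := skip_mem_expand (i := i) (s := i) (S := S)
  rwa [skip, if_neg (lt_irrefl i)] at h

theorem expand_insert (i s : ℤ) (S : Finset ℤ) :
    expand i (insert s S) = insert (skip i s) (expand i S) := by
  rw [expand, Finset.image_insert, expand, Finset.insert_comm]

theorem skip_mem_block_expand {s t : ℤ} :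
    skip i t ∈ block (expand i S) (skip i s) ↔ t ∈ block S s := by
  have hskip {a b : ℤ} : skip i a ≤ skip i b ↔ a ≤ b := (skip_strictMono i).le_iff_le
  simp only [mem_block_iff]
  constructor
  · intro h z h₁ h₂
    rw [← skip_mem_expand (i := i)]
    apply h <;> simp only [min_le_iff, le_max_iff, hskip] at * <;> assumption
  · intro h z h₁ h₂
    obtain rfl | ⟨z, rfl⟩ := eq_or_exists_eq_skip i z
    · exact self_mem_expand _ _
    · apply skip_mem_expand.2
      apply h <;> simp only [min_le_iff, le_max_iff, hskip] at * <;> assumption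

theorem IsLeftSpot.skip (h : IsLeftSpot S x l) :
    IsLeftSpot (expand i S) (skip i x) (skip i l) := by
  refine ⟨by rw [skip_mem_expand]; exact h.notMem, mem_block_iff.2 fun z h₁ h₂ => ?_⟩
  have hlt := skip_strictMono i h.lt
  obtain rfl | ⟨z, rfl⟩ := eq_or_exists_eq_skip i z
  · exact self_mem_expand _ _
  · have hlz : l < z := (skip_strictMono i).lt_iff_lt.1 (by omega)
    have hzx : z ≤ x := (skip_strictMono i).le_iff_le.1 (by omega)
    exact skip_mem_expand.2 (mem_block_iff.1 h.add_one_mem z (by omega) (by omega))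

theorem IsRightSpot.skip (h : IsRightSpot S x r) :
    IsRightSpot (expand i S) (skip i x) (skip i r) := by
  refine ⟨by rw [skip_mem_expand]; exact h.notMem, mem_block_iff.2 fun z h₁ h₂ => ?_⟩
  have hlt := skip_strictMono i h.lt
  obtain rfl | ⟨z, rfl⟩ := eq_or_exists_eq_skip i z
  · exact self_mem_expand _ _
  · have hzr : z < r := (skip_strictMono i).lt_iff_lt.1 (by omega)
    have hxz : x ≤ z := (skip_strictMono i).le_iff_le.1 (by omega)
    exact skip_mem_expand.2 (mem_block_iff.1 h.sub_one_mem z (by omega) (by omega))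

theorem isLeftSpot_expand_self (h : i - 1 ∉ S) : IsLeftSpot (expand i S) i (i - 1) :=
  ⟨by rwa [sub_one_mem_expand],
    by rw [sub_add_cancel, mem_block_self_iff]; exact self_mem_expand i S⟩

theorem isRightSpot_expand_self (h : i ∉ S) : IsRightSpot (expand i S) i (i + 1) :=
  ⟨by rwa [add_one_mem_expand],
    by rw [add_sub_cancel_right, mem_block_self_iff]; exact self_mem_expand i S⟩

theorem expand_eq_Icc_iff {n : ℕ} :
    expand i S = Finset.Icc 1 ((n + 1 : ℕ) : ℤ) ↔
      (1 ≤ i ∧ i ≤ n + 1) ∧ S = Finset.Icc 1 (n : ℤ) := by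
  push_cast
  constructor
  · intro h
    have hi : i ∈ Finset.Icc 1 ((n : ℤ) + 1) := h ▸ self_mem_expand i S
    rw [Finset.mem_Icc] at hi
    refine ⟨hi, ?_⟩
    ext s
    rw [← skip_mem_expand (i := i), h, Finset.mem_Icc, Finset.mem_Icc]
    unfold skip
    split_ifs <;> omega
  · rintro ⟨hi, rfl⟩
    ext z
    obtain rfl | ⟨s, rfl⟩ := eq_or_exists_eq_skip i z
    · simpa only [self_mem_expand, true_iff, Finset.mem_Icc] using hi
    · rw [skip_mem_expand, Finset.mem_Icc, Finset.mem_Icc]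
      unfold skip
      split_ifs <;> omega

end Block

section Parking

variable {α : Type*}

/-- The last car of `W` (listed backwards) whose preferred spot lies in the interval of `S` that
contains `x`. -/
def lastCar (v : α → ℤ) (W : List α) (S : Finset ℤ) (x : ℤ) : Option α :=
  W.find? fun b => v b ∈ block S x

theorem mem_of_lastCar_eq_some {v : α → ℤ} {b : α} {W : List α} {S : Finset ℤ} {x : ℤ}
    (hb : lastCar v W S x = some b) : b ∈ W ∧ v b ∈ block S x :=
  ⟨List.mem_of_find?_eq_some hb,
    of_decide_eq_true (List.find?_some (p := fun b => decide (v b ∈ block S x)) hb)⟩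

variable [LinearOrder α]

/-- The procedure `spotsRev` for cars from an arbitrary linearly ordered set with preferred spots
`v`. Removing the first car changes the preferences, so that the induction needs this generality. -/
def parked (v : α → ℤ) : List α → Finset ℤ
  | [] => ∅
  | a :: W =>
    if h : v a ∈ parked v W then
      match lastCar v W (parked v W) (v a) with
      | some b =>
        if a < b then
          insert ((block (parked v W) (v a)).min' (block_nonempty h) - 1) (parked v W)
        else
          insert ((block (parked v W) (v a)).max' (block_nonempty h) + 1) (parked v W)
      | none => parked v W
    else
      insert (v a) (parked v W)

theorem Letter.val_monotone : Monotone Letter.val := fun _ _ h => Prod.Lex.monotone_fst _ _ h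

theorem spotsRev_eq_parked (W : List Letter) : spotsRev W = parked Letter.val W := by
  induction W with
  | nil => rfl
  | cons a W ih =>
    simp only [spotsRev, parked, lastCar, ih]
    split_ifs
    · cases W.find? fun b => b.val ∈ block (parked Letter.val W) a.val <;> rfl
    · rfl

variable {v : α → ℤ} {a b f : α} {W : List α}

theorem parked_cons_of_notMem (h : v a ∉ parked v W) :
    parked v (a :: W) = insert (v a) (parked v W) := by
  rw [parked, dif_neg h]

theorem parked_cons_of_lt {l : ℤ} (hb : lastCar v W (parked v W) (v a) = some b) (hab : a < b)
    (hl : IsLeftSpot (parked v W) (v a) l) : parked v (a :: W) = insert l (parked v W) := by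
  have h : v a ∈ parked v W := left_mem_of_mem_block hl.add_one_mem
  rw [parked, dif_pos h, hb]
  simp only [if_pos hab, ((isLeftSpot_min' h).le hl).antisymm (hl.le (isLeftSpot_min' h))]

theorem parked_cons_of_not_lt {r : ℤ} (hb : lastCar v W (parked v W) (v a) = some b)
    (hab : ¬ a < b) (hr : IsRightSpot (parked v W) (v a) r) :
    parked v (a :: W) = insert r (parked v W) := by
  have h : v a ∈ parked v W := left_mem_of_mem_block hr.sub_one_mem
  rw [parked, dif_pos h, hb]
  simp only [if_neg hab, ((isRightSpot_max' h).le hr).antisymm (hr.le (isRightSpot_max' h))]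

theorem exists_parked_cons_eq_insert (v : α → ℤ) (a : α) (W : List α) :
    ∃ p, parked v (a :: W) = insert p (parked v W) ∧ v a ∈ block (insert p (parked v W)) p := by
  by_cases h : v a ∈ parked v W
  · rcases hb : lastCar v W (parked v W) (v a) with _ | b
    · refine ⟨v a, ?_, mem_block_self_iff.2 (Finset.mem_insert_self _ _)⟩
      rw [parked, dif_pos h, hb, Finset.insert_eq_of_mem h]
    · by_cases hab : a < b
      · exact ⟨_, parked_cons_of_lt hb hab (isLeftSpot_min' h),
          (isLeftSpot_min' h).mem_block_insert⟩
      · exact ⟨_, parked_cons_of_not_lt hb hab (isRightSpot_max' h),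
          (isRightSpot_max' h).mem_block_insert⟩
  · exact ⟨v a, parked_cons_of_notMem h, mem_block_self_iff.2 (Finset.mem_insert_self _ _)⟩

theorem parked_subset_cons (v : α → ℤ) (a : α) (W : List α) :
    parked v W ⊆ parked v (a :: W) := by
  obtain ⟨p, hp, -⟩ := exists_parked_cons_eq_insert v a W
  exact hp ▸ Finset.subset_insert _ _

theorem apply_mem_parked (hb : b ∈ W) : v b ∈ parked v W := by
  induction W with
  | nil => simp at hb
  | cons a W ih =>
    rcases List.mem_cons.1 hb with rfl | hb
    · obtain ⟨p, hp, hbp⟩ := exists_parked_cons_eq_insert v b W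
      exact hp ▸ block_subset _ _ hbp
    · exact parked_subset_cons v a W (ih hb)

theorem exists_mem_block_of_mem_parked {x : ℤ} (hx : x ∈ parked v W) :
    ∃ b ∈ W, v b ∈ block (parked v W) x := by
  induction W with
  | nil => simp [parked] at hx
  | cons a W ih =>
    obtain ⟨p, hp, hap⟩ := exists_parked_cons_eq_insert v a W
    rw [← hp] at hap
    rcases Finset.mem_insert.1 (hp ▸ hx) with rfl | hxW
    · exact ⟨a, List.mem_cons_self, hap⟩
    · obtain ⟨b, hb, hbx⟩ := ih hxW
      exact ⟨b, List.mem_cons_of_mem _ hb, block_mono (parked_subset_cons v a W) x hbx⟩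

theorem exists_lastCar_eq_some {x : ℤ} (hx : x ∈ parked v W) :
    ∃ b, lastCar v W (parked v W) x = some b := by
  obtain ⟨b, hb, hbx⟩ := exists_mem_block_of_mem_parked hx
  exact Option.isSome_iff_exists.1 (List.find?_isSome.2 ⟨b, hb, decide_eq_true hbx⟩)

/-- The preferences of the other cars once the car `f` and the spot `v f` are removed. A car that
also preferred `v f` goes to the side on which it would have parked next to `f`. -/
def contract (v : α → ℤ) (f a : α) : ℤ :=
  if a < f then min (v a) (v f - 1) else max (v a - 1) (v f)

theorem contract_of_lt (h : a < f) : contract v f a = min (v a) (v f - 1) := if_pos h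

theorem contract_of_le (h : f ≤ a) : contract v f a = max (v a - 1) (v f) := if_neg h.not_gt

theorem contract_monotone (hv : Monotone v) (f : α) : Monotone (contract v f) := by
  intro a b hab
  have hle := hv hab
  rcases lt_or_ge a f with haf | haf
  · rw [contract_of_lt haf, contract]
    split_ifs <;> omega
  · rw [contract_of_le haf, contract_of_le (haf.trans hab)]
    omega

theorem skip_contract_of_ne (hv : Monotone v) (h : v a ≠ v f) :
    skip (v f) (contract v f a) = v a := by
  unfold skip
  rcases lt_or_ge a f with haf | haf
  · have := hv haf.le
    rw [contract_of_lt haf]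
    split_ifs <;> omega
  · have := hv haf
    rw [contract_of_le haf]
    split_ifs <;> omega

theorem abs_skip_contract_sub_le_of_eq (h : v a = v f) :
    |skip (v f) (contract v f a) - v f| ≤ 1 := by
  unfold skip contract
  split_ifs <;> rw [abs_le] <;> omega

theorem apply_mem_block_expand (hv : Monotone v) {S : Finset ℤ} (h : contract v f a ∈ S) :
    v a ∈ block (expand (v f) S) (skip (v f) (contract v f a)) := by
  by_cases hne : v a = v f
  · have habs := abs_le.1 (abs_skip_contract_sub_le_of_eq hne)
    refine mem_block_iff.2 fun z h₁ h₂ => ?_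
    rcases (by omega : z = v f ∨ z = skip (v f) (contract v f a)) with rfl | rfl
    · exact self_mem_expand _ _
    · exact skip_mem_expand.2 h
  · rw [skip_contract_of_ne hv hne, mem_block_self_iff, ← skip_contract_of_ne hv hne]
    exact skip_mem_expand.2 h

theorem apply_mem_block_expand_iff (hv : Monotone v) {S : Finset ℤ} (ha : contract v f a ∈ S)
    (hb : contract v f b ∈ S) :
    v b ∈ block (expand (v f) S) (v a) ↔ contract v f b ∈ block S (contract v f a) := by
  rw [← block_eq_of_mem (apply_mem_block_expand hv ha), mem_block_comm,
    ← block_eq_of_mem (apply_mem_block_expand hv hb), skip_mem_block_expand, mem_block_comm]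

theorem lastCar_append_singleton_expand (hv : Monotone v) {S : Finset ℤ}
    (hW : ∀ b ∈ W, contract v f b ∈ S) (ha : contract v f a ∈ S)
    (hb : lastCar (contract v f) W S (contract v f a) = some b) :
    lastCar v (W ++ [f]) (expand (v f) S) (v a) = some b := by
  have hW' : lastCar v W (expand (v f) S) (v a) = some b := by
    rw [← hb]
    refine List.find?_congr fun x hx => ?_
    rw [decide_eq_decide, apply_mem_block_expand_iff hv ha (hW x hx)]
  rw [lastCar, List.find?_append, ← lastCar, hW', Option.some_or]

theorem lt_of_lastCar_append_singleton (hv : Monotone v) {S : Finset ℤ}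
    (hW : ∀ b ∈ W, contract v f b ∈ S) (haf : a < f) (hf : v f - 1 ∉ S)
    (hb : lastCar v (W ++ [f]) (expand (v f) S) (v f) = some b) (ha : v a = v f) : a < b := by
  obtain ⟨hbW, hblock⟩ := mem_of_lastCar_eq_some hb
  by_contra! hba
  have hbf := hba.trans_lt haf
  have hle := hv hba
  have hbW : b ∈ W := (List.mem_append.1 hbW).resolve_right
    fun h => hbf.ne (List.mem_singleton.1 h)
  have hbS := hW b hbW
  rw [contract_of_lt hbf] at hbS
  have hlt : v b < v f := by
    by_contra hnlt
    exact hf (by rwa [min_eq_right (by omega)] at hbS)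
  exact hf (sub_one_mem_expand.1 (mem_block_iff.1 hblock _ (by omega) (by omega)))

theorem not_lt_of_lastCar_append_singleton (hv : Monotone v) {S : Finset ℤ}
    (hW : ∀ b ∈ W, contract v f b ∈ S) (hfa : f < a) (hf : v f ∉ S)
    (hb : lastCar v (W ++ [f]) (expand (v f) S) (v f) = some b) (ha : v a = v f) : ¬ a < b := by
  obtain ⟨hbW, hblock⟩ := mem_of_lastCar_eq_some hb
  intro hab
  have hfb := hfa.trans hab
  have hle := hv hab.le
  have hbW : b ∈ W := (List.mem_append.1 hbW).resolve_right
    fun h => hfb.ne' (List.mem_singleton.1 h)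
  have hbS := hW b hbW
  rw [contract_of_le hfb.le] at hbS
  have hlt : v f < v b := by
    by_contra hnlt
    exact hf (by rwa [max_eq_right (by omega)] at hbS)
  exact hf (add_one_mem_expand.1 (mem_block_iff.1 hblock _ (by omega) (by omega)))

section AppendSingleton

variable (hv : Monotone v) (hW : parked v (W ++ [f]) = expand (v f) (parked (contract v f) W))

include hv hW

theorem parked_cons_append_singleton_of_mem (h : contract v f a ∈ parked (contract v f) W) :
    parked v (a :: (W ++ [f])) = expand (v f) (parked (contract v f) (a :: W)) := by
  obtain ⟨b, hb⟩ := exists_lastCar_eq_some h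
  have hb' := lastCar_append_singleton_expand hv (fun _ => apply_mem_parked) h hb
  have hmem := apply_mem_block_expand hv h
  rw [← hW] at hb'
  by_cases hab : a < b
  · have hl := isLeftSpot_min' h
    rw [parked_cons_of_lt hb hab hl, expand_insert, ← hW]
    exact parked_cons_of_lt hb' hab (hW ▸ hl.skip.of_mem_block hmem)
  · have hr := isRightSpot_max' h
    rw [parked_cons_of_not_lt hb hab hr, expand_insert, ← hW]
    exact parked_cons_of_not_lt hb' hab (hW ▸ hr.skip.of_mem_block hmem)

theorem parked_cons_append_singleton_of_ne (h : contract v f a ∉ parked (contract v f) W)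
    (hne : v a ≠ v f) :
    parked v (a :: (W ++ [f])) = expand (v f) (parked (contract v f) (a :: W)) := by
  rw [parked_cons_of_notMem h, expand_insert, skip_contract_of_ne hv hne, ← hW]
  refine parked_cons_of_notMem ?_
  rwa [hW, ← skip_contract_of_ne hv hne, skip_mem_expand]

theorem parked_cons_append_singleton_of_eq (h : contract v f a ∉ parked (contract v f) W)
    (hvaf : v a = v f) (haf : a ≠ f) :
    parked v (a :: (W ++ [f])) = expand (v f) (parked (contract v f) (a :: W)) := by
  obtain ⟨b, hb⟩ : ∃ b, lastCar v (W ++ [f]) (parked v (W ++ [f])) (v f) = some b :=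
    exists_lastCar_eq_some (apply_mem_parked (by simp))
  rw [parked_cons_of_notMem h, expand_insert, ← hW]
  have hb' := hb
  rw [hW] at hb'
  rw [← hvaf] at hb
  rcases haf.lt_or_gt with hlt | hgt
  · have hc : contract v f a = v f - 1 := by rw [contract_of_lt hlt, hvaf]; omega
    have hs : skip (v f) (v f - 1) = v f - 1 := if_pos (sub_one_lt _)
    rw [hc] at h ⊢
    rw [hs]
    exact parked_cons_of_lt hb
      (lt_of_lastCar_append_singleton hv (fun _ => apply_mem_parked) hlt h hb' hvaf)
      (by rw [hW, hvaf]; exact isLeftSpot_expand_self h)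
  · have hc : contract v f a = v f := by rw [contract_of_le hgt.le, hvaf]; omega
    have hs : skip (v f) (v f) = v f + 1 := if_neg (lt_irrefl _)
    rw [hc] at h ⊢
    rw [hs]
    exact parked_cons_of_not_lt hb
      (not_lt_of_lastCar_append_singleton hv (fun _ => apply_mem_parked) hgt h hb' hvaf)
      (by rw [hW, hvaf]; exact isRightSpot_expand_self h)

end AppendSingleton

theorem parked_append_singleton (hv : Monotone v) (hf : f ∉ W) :
    parked v (W ++ [f]) = expand (v f) (parked (contract v f) W) := by
  induction W with
  | nil => simp [parked, expand]
  | cons a W ih =>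
    rw [List.mem_cons, not_or] at hf
    replace ih := ih hf.2
    rw [List.cons_append]
    by_cases h : contract v f a ∈ parked (contract v f) W
    · exact parked_cons_append_singleton_of_mem hv ih h
    by_cases hvaf : v a = v f
    · exact parked_cons_append_singleton_of_eq hv ih h hvaf (Ne.symm hf.1)
    · exact parked_cons_append_singleton_of_ne hv ih h hvaf

end Parking

/-! ### Trimming a product of partial sums of the variables -/

section PartialSum

variable {R : Type*} [CommRing R] {n : ℕ}

theorem trim_prod {α : Type*} [LinearOrder α] (i : Fin n) (S : Finset α)
    (p : α → MvPolynomial (Fin (n + 1)) R) :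
    trim i (∏ a ∈ S, p a) = ∑ b ∈ S, trim i (p b) * (∏ a ∈ S with a < b, omitVar i.castSucc (p a)) *
      ∏ a ∈ S with b < a, omitVar i.succ (p a) := by
  have hsub (a : α) : omitVar i.succ (p a) - X i * trim i (p a) = omitVar i.castSucc (p a) := by
    rw [X_mul_trim, sub_sub_cancel]
  have h := Finset.prod_sub_ordered S (fun a => omitVar i.succ (p a)) fun a => X i * trim i (p a)
  simp only [hsub] at h
  rw [← X_mul_cancel_left_iff (i := i), X_mul_trim, map_prod, map_prod, h, sub_sub_cancel,
    Finset.mul_sum]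
  simp only [mul_assoc]

variable (R n) in
/-- The partial sum `x_0 + ⋯ + x_{k-1}` of the variables of `R[x_0, …, x_{n-1}]`, truncated to `0`
for `k < 0` and to the sum of all variables for `k > n`. -/
noncomputable def partialSum (k : ℤ) : MvPolynomial (Fin n) R :=
  ∑ j : Fin n, if (j : ℤ) < k then X j else 0

theorem omitVar_partialSum (i : Fin (n + 1)) (k : ℤ) :
    omitVar i (partialSum R (n + 1) k) = partialSum R n (if k ≤ i then k else k - 1) := by
  have hlt (j : Fin n) : ((i.succAbove j : Fin (n + 1)) : ℤ) < k ↔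
      (j : ℤ) < if k ≤ i then k else k - 1 := by
    simp only [Fin.succAbove, Fin.lt_def, Fin.val_castSucc]
    split_ifs <;> simp only [Fin.val_castSucc, Fin.val_succ] <;> omega
  simp only [partialSum, Fin.sum_univ_succAbove _ i, map_add, map_sum, apply_ite (omitVar i),
    omitVar_X_self, omitVar_X_succAbove, map_zero, ite_self, zero_add, hlt]

theorem partialSum_natCast (i : Fin n) : partialSum R n i = ∑ j ∈ Finset.Iio i, X j := by
  simp only [partialSum, ← Finset.sum_filter, Nat.cast_lt, ← Fin.lt_def, Finset.filter_gt_eq_Iio]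

theorem partialSum_natCast_add_one (i : Fin n) :
    partialSum R n (i + 1) = ∑ j ∈ Finset.Iic i, X j := by
  simp only [partialSum, ← Finset.sum_filter, Int.lt_add_one_iff, Nat.cast_le, ← Fin.le_def,
    Finset.filter_ge_eq_Iic]

theorem trim_partialSum (i : Fin n) (k : ℤ) :
    trim i (partialSum R (n + 1) k) = if k = i + 1 then 1 else 0 := by
  rw [← X_mul_cancel_left_iff (i := i), X_mul_trim, omitVar_partialSum, omitVar_partialSum,
    Fin.val_succ, Fin.val_castSucc, mul_ite, mul_one, mul_zero]
  push_cast
  rcases lt_trichotomy k (i + 1) with h | rfl | h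
  · rw [if_pos h.le, if_pos (by omega), if_neg h.ne, sub_self]
  · rw [if_pos le_rfl, if_neg (by omega), if_pos rfl, add_sub_cancel_right,
      partialSum_natCast_add_one, partialSum_natCast, ← Finset.sum_Iio_add_eq_sum_Iic,
      add_sub_cancel_left]
  · rw [if_neg h.not_ge, if_neg (by omega), if_neg h.ne', sub_self]

theorem trim_prod_partialSum {α : Type*} [LinearOrder α] {v : α → ℤ} (hv : Monotone v)
    (i : Fin n) (S : Finset α) :
    trim i (∏ a ∈ S, partialSum R (n + 1) (v a)) =
      ∑ f ∈ S with v f = i + 1, ∏ a ∈ S.erase f, partialSum R n (contract v f a) := by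
  rw [trim_prod, Finset.sum_filter]
  refine Finset.sum_congr rfl fun f _ => ?_
  rw [trim_partialSum]
  split_ifs with hvf
  swap
  · rw [zero_mul, zero_mul]
  have hlt (a : α) (h : a < f) :
      omitVar i.castSucc (partialSum R (n + 1) (v a)) = partialSum R n (contract v f a) := by
    have := hv h.le
    rw [omitVar_partialSum, Fin.val_castSucc, contract_of_lt h]
    congr 1
    split_ifs <;> omega
  have hgt (a : α) (h : f < a) :
      omitVar i.succ (partialSum R (n + 1) (v a)) = partialSum R n (contract v f a) := by
    have := hv h.le
    rw [omitVar_partialSum, Fin.val_succ, contract_of_le h.le]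
    congr 1
    push_cast
    split_ifs <;> omega
  have hS : S.erase f = {a ∈ S | a < f} ∪ {a ∈ S | f < a} := by
    ext a
    simp only [Finset.mem_erase, Finset.mem_union, Finset.mem_filter, ne_iff_lt_or_gt]
    tauto
  rw [hS, Finset.prod_union (Finset.disjoint_filter.2 fun a _ h => h.not_gt), one_mul]
  congr 1
  · exact Finset.prod_congr rfl fun a ha => hlt a (Finset.mem_filter.1 ha).2
  · exact Finset.prod_congr rfl fun a ha => hgt a (Finset.mem_filter.1 ha).2

end PartialSum

/-! ### Counting parking words -/

section ParkingOrders

variable {α : Type*} {S : Finset α} {f : α} {W : List α}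

/-- The set of the `|S|!` lists that contain every element of `S` exactly once. -/
def orderings (S : Finset α) : Finset (List α) := ⟨S.val.lists, Multiset.lists_nodup_finset S⟩

theorem mem_orderings : W ∈ orderings S ↔ (W : Multiset α) = S.val := by
  rw [← Finset.mem_val, orderings, Multiset.mem_lists_iff, eq_comm, Multiset.quot_mk_to_coe]

theorem card_orderings (S : Finset α) : (orderings S).card = S.card.factorial := by
  rw [← Finset.length_toList S, ← List.length_permutations, ← Multiset.coe_card,
    ← Multiset.lists_coe, Finset.coe_toList, ← Finset.card_val, orderings]

theorem length_of_mem_orderings (h : W ∈ orderings S) : W.length = S.card := by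
  rw [← Multiset.coe_card, mem_orderings.1 h, Finset.card_val]

theorem nodup_of_mem_orderings (h : W ∈ orderings S) : W.Nodup := by
  rw [← Multiset.coe_nodup, mem_orderings.1 h]
  exact S.nodup

theorem mem_of_mem_orderings {a : α} (h : W ∈ orderings S) : a ∈ W ↔ a ∈ S := by
  rw [← Multiset.mem_coe, mem_orderings.1 h, Finset.mem_val]

theorem cons_mem_orderings [DecidableEq α] :
    f :: W ∈ orderings S ↔ f ∈ S ∧ W ∈ orderings (S.erase f) := by
  rw [mem_orderings, mem_orderings, Finset.erase_val, ← Multiset.cons_coe]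
  constructor
  · intro h
    refine ⟨by rw [← Finset.mem_val, ← h]; exact Multiset.mem_cons_self f _, ?_⟩
    rw [← h, Multiset.erase_cons_head]
  · rintro ⟨hf, h⟩
    rw [h, Multiset.cons_erase (by rwa [Finset.mem_val])]

variable [LinearOrder α] {v : α → ℤ}

/-- The orders in which the cars of `S`, with preferred spots `v`, occupy exactly the spots
`1, …, |S|`. -/
noncomputable def parkingOrders (v : α → ℤ) (S : Finset α) : Finset (List α) :=
  {W ∈ orderings S | parked v W.reverse = Finset.Icc 1 (S.card : ℤ)}

theorem cons_mem_parkingOrders (hv : Monotone v) :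
    f :: W ∈ parkingOrders v S ↔
      (f ∈ S ∧ 1 ≤ v f ∧ v f ≤ S.card) ∧ W ∈ parkingOrders (contract v f) (S.erase f) := by
  simp only [parkingOrders, Finset.mem_filter, cons_mem_orderings, List.reverse_cons]
  rw [and_assoc, and_assoc, and_congr_right_iff]
  intro hf
  rw [and_left_comm, and_congr_right_iff]
  intro hW
  have hfW : f ∉ W.reverse := by
    rw [List.mem_reverse, mem_of_mem_orderings hW]
    exact Finset.notMem_erase f S
  rw [parked_append_singleton hv hfW, ← Finset.card_erase_add_one hf, expand_eq_Icc_iff,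
    Nat.cast_succ]

theorem parkingOrders_empty (v : α → ℤ) : parkingOrders v ∅ = {[]} := by
  ext W
  rw [parkingOrders, Finset.mem_filter, mem_orderings, Finset.empty_val, Multiset.coe_eq_zero,
    Finset.mem_singleton, and_iff_left_of_imp]
  rintro rfl
  rfl

theorem card_parkingOrders (hv : Monotone v) (hS : S.Nonempty) :
    (parkingOrders v S).card = ∑ f ∈ S with 1 ≤ v f ∧ v f ≤ S.card,
      (parkingOrders (contract v f) (S.erase f)).card := by
  have h : parkingOrders v S = {f ∈ S | 1 ≤ v f ∧ v f ≤ S.card}.biUnion fun f =>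
      (parkingOrders (contract v f) (S.erase f)).image (List.cons f) := by
    ext W
    obtain _ | ⟨f, W⟩ := W
    · suffices [] ∉ parkingOrders v S by simpa
      intro h
      have hlen := length_of_mem_orderings (Finset.mem_filter.1 h).1
      exact hS.card_ne_zero hlen.symm
    · rw [cons_mem_parkingOrders hv]
      simp
  rw [h, Finset.card_biUnion]
  · exact Finset.sum_congr rfl fun f _ => Finset.card_image_of_injective _ List.cons_injective
  · intro f _ g _ hfg
    rw [Function.onFun, Finset.disjoint_left]
    intro W hf hg
    obtain ⟨_, _, rfl⟩ := Finset.mem_image.1 hf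
    obtain ⟨_, _, h⟩ := Finset.mem_image.1 hg
    exact hfg (List.cons.inj h).1.symm

omit [LinearOrder α] in
theorem sum_fin_sum_filter_eq_add_one {M : Type*} [AddCommMonoid M] (n : ℕ) (S : Finset α)
    (v : α → ℤ) (g : α → M) :
    ∑ i : Fin n, ∑ f ∈ S with v f = i + 1, g f = ∑ f ∈ S with 1 ≤ v f ∧ v f ≤ n, g f := by
  refine (Finset.sum_comm' (t' := {f ∈ S | 1 ≤ v f ∧ v f ≤ n})
    (s' := fun f => {i : Fin n | v f = i + 1}) fun i f => ?_).trans
    (Finset.sum_congr rfl fun f hf => ?_)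
  · simp only [Finset.mem_univ, Finset.mem_filter, true_and]
    have := i.isLt
    constructor
    · rintro ⟨hf, h⟩
      exact ⟨h, hf, by omega, by omega⟩
    · rintro ⟨h, hf, -⟩
      exact ⟨hf, h⟩
  · obtain ⟨-, h₁, hn⟩ := Finset.mem_filter.1 hf
    have hi : ({i : Fin n | v f = i + 1} : Finset (Fin n)) = {⟨(v f - 1).toNat, by omega⟩} := by
      ext i
      rw [Finset.mem_filter_univ, Finset.mem_singleton, Fin.ext_iff]
      dsimp only
      omega
    rw [hi, Finset.sum_singleton]

theorem trimSum_prod_partialSum {R : Type*} [CommRing R] (hv : Monotone v) {n : ℕ}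
    (hS : S.card = n) :
    trimSum R n (∏ a ∈ S, partialSum R (n + 1) (v a)) = (parkingOrders v S).card := by
  induction n generalizing v S with
  | zero =>
    obtain rfl := Finset.card_eq_zero.1 hS
    rw [Finset.prod_empty, trimSum, lcoeff_apply, coeff_zero_one, parkingOrders_empty,
      Finset.card_singleton, Nat.cast_one]
  | succ n ih =>
    have hne : S.Nonempty := Finset.card_ne_zero.1 (by omega)
    simp only [trimSum_succ, trim_prod_partialSum hv, map_sum]
    rw [sum_fin_sum_filter_eq_add_one, card_parkingOrders hv hne, hS, Nat.cast_sum]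
    refine Finset.sum_congr rfl fun f hf => ih (contract_monotone hv f) ?_
    rw [Finset.card_erase_of_mem (Finset.mem_filter.1 hf).1, hS, Nat.add_sub_cancel]

end ParkingOrders

section Letters

variable {m : ℕ} {c : Fin m → ℕ}

/-- The enumeration of the letters `i^(j)` of `alphabet c`, both indices being shifted by one. -/
def letterEmbedding (c : Fin m → ℕ) : (Σ i : Fin m, Fin (c i)) ↪ Letter where
  toFun p := toLex ((p.1 : ℤ) + 1, Nat.succPNat p.2)
  inj' := by
    rintro ⟨i, j⟩ ⟨i', j'⟩ h
    obtain ⟨hi, hj⟩ := Prod.ext_iff.1 (toLex.injective h)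
    obtain rfl : i = i' := by simpa [Fin.ext_iff] using hi
    obtain rfl : j = j' := by simpa [Fin.ext_iff] using hj
    rfl

/-- The set `alphabet c` as a `Finset`. -/
def letters (c : Fin m → ℕ) : Finset Letter := Finset.univ.map (letterEmbedding c)

theorem mem_letters {a : Letter} : a ∈ letters c ↔ a ∈ alphabet c := by
  simp only [letters, Finset.mem_map, Finset.mem_univ, true_and, alphabet, Set.mem_ofPred_eq]
  constructor
  · rintro ⟨⟨i, j⟩, rfl⟩
    exact ⟨i, rfl, j.isLt⟩
  · rintro ⟨i, hi, hj⟩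
    have hpos := a.sup.pos
    refine ⟨⟨i, ⟨a.sup - 1, by omega⟩⟩, toLex.symm.injective (Prod.ext hi.symm (PNat.eq ?_))⟩
    exact Nat.sub_add_cancel hpos

theorem card_letters (c : Fin m → ℕ) : (letters c).card = ∑ i, c i := by
  simp [letters]

theorem yPoly_eq_prod_partialSum (c : Fin m → ℕ) :
    yPoly c = ∏ a ∈ letters c, partialSum ℚ (m + 1) a.val := by
  have hval (i : Fin m) (j : Fin (c i)) :
      (letterEmbedding c ⟨i, j⟩).val = (i.castSucc : ℕ) + 1 := rfl
  simp only [yPoly, letters, Finset.prod_map, Fintype.prod_sigma, hval, Finset.prod_const,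
    Finset.card_univ, Fintype.card_fin, partialSum_natCast_add_one, Fin.sum_Iic_castSucc]

theorem injectiveWords_eq_orderings (hc : ∑ i, c i = m) :
    injectiveWords c = orderings (letters c) := by
  ext W
  rw [Finset.mem_coe]
  constructor
  · rintro ⟨hnodup, hlen, hW⟩
    rw [mem_orderings]
    refine Multiset.eq_of_le_of_card_le
      ((Multiset.le_iff_subset (Multiset.coe_nodup.2 hnodup)).2 fun a ha =>
        mem_letters.2 (hW a ha)) ?_
    rw [Finset.card_val, card_letters, hc, Multiset.coe_card, hlen]
  · intro hW
    refine ⟨nodup_of_mem_orderings hW, ?_, fun a ha => mem_letters.1 ?_⟩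
    · rw [length_of_mem_orderings hW, card_letters, hc]
    · rwa [← mem_of_mem_orderings hW]

theorem ncard_injectiveWords (hc : ∑ i, c i = m) : (injectiveWords c).ncard = m.factorial := by
  rw [injectiveWords_eq_orderings hc, Set.ncard_coe_finset, card_orderings, card_letters, hc]

theorem setOf_isParkingWord_eq_parkingOrders (hc : ∑ i, c i = m) :
    {W | W ∈ injectiveWords c ∧ IsParkingWord W} =
      (parkingOrders Letter.val (letters c) : Set (List Letter)) := by
  ext W
  rw [Set.mem_ofPred_eq, injectiveWords_eq_orderings hc, Finset.mem_coe, Finset.mem_coe,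
    parkingOrders, Finset.mem_filter, IsParkingWord, spots, spotsRev_eq_parked]
  exact and_congr_right fun hW => by rw [length_of_mem_orderings hW]

theorem isHomogeneous_yPoly (c : Fin m → ℕ) : (yPoly c).IsHomogeneous (∑ i, c i) := by
  refine IsHomogeneous.prod _ _ _ fun i _ => ?_
  simpa only [one_mul] using
    (IsHomogeneous.sum (Finset.Iic i) _ 1 fun j _ => isHomogeneous_X ℚ j.castSucc).pow (c i)

theorem eval_one_mixedEulerian (hc : ∑ i, c i = m) :
    eval 1 (mixedEulerian c) = trimSum ℚ m (yPoly c) :=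
  (isABBReduction_abbReduction _).eval_one_eq_trimSum
    (by simpa only [hc] using isHomogeneous_yPoly c)

end Letters

end OmegaParking

theorem mainTheorem9 (m : ℕ) (c : Fin m → ℕ) (hc : ∑ i, c i = m) :
    (∃! r, OmegaParking.IsABBReduction (OmegaParking.yPoly c) r) ∧
    (OmegaParking.injectiveWords c).ncard = m.factorial ∧
    MvPolynomial.eval (fun _ => (1 : ℚ)) (OmegaParking.mixedEulerian c) =
      ({W | W ∈ OmegaParking.injectiveWords c ∧ OmegaParking.IsParkingWord W}.ncard : ℚ) := by
  refine ⟨OmegaParking.existsUnique_isABBReduction _, OmegaParking.ncard_injectiveWords hc, ?_⟩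
  calc MvPolynomial.eval 1 (OmegaParking.mixedEulerian c)
      = OmegaParking.trimSum ℚ m (OmegaParking.yPoly c) := OmegaParking.eval_one_mixedEulerian hc
    _ = (OmegaParking.parkingOrders OmegaParking.Letter.val (OmegaParking.letters c)).card := by
      rw [OmegaParking.yPoly_eq_prod_partialSum]
      exact OmegaParking.trimSum_prod_partialSum OmegaParking.Letter.val_monotone
        ((OmegaParking.card_letters c).trans hc)
    _ = ({W | W ∈ OmegaParking.injectiveWords c ∧ OmegaParking.IsParkingWord W}.ncard : ℚ) := by
      rw [OmegaParking.setOf_isParkingWord_eq_parkingOrders hc, Set.ncard_coe_finset]
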